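/- Let $k$ be a commutative Artinian ring, let $\Lambda$ be a $k$-algebra that is finitely generated and projective as a $k$-module, let $\psi\colon\Lambda\to\Lambda$ be a $k$-algebra automorphism, and let $t\ge 1$ be an integer. Write $\Lambda^{e}=\Lambda\otimes_k\Lambda^{\mathrm{op}}$. For automorphisms $\phi,\rho$ of $\Lambda$ and a bimodule $X$, let ${}_{\phi}X_{\rho}$ be $X$ with the actions $a\cdot x\cdot b=\phi(a)\,x\,\rho(b)$; apply the same notation to extensions. Let $$\mathrm{HH}^{t*}({}_{\psi^*}\Lambda_1,\Lambda)=\bigoplus_{m\ge 0}\mathrm{Ext}^{tm}_{\Lambda^{e}}({}_{\psi^m}\Lambda_1,\Lambda),$$ with the product $\eta\theta=\eta\circ{}_{\psi^m}\theta$ (Yoneda product) for homogeneous $\eta,\theta$ of degrees $|\eta|=tm$ and $|\theta|=tl$. Let $\mathbb B$ be the bar resolution of $\Lambda$, where $B^N$ is the $(N+2)$-fold tensor product of $\Lambda$ over $k$; then ${}_{\psi^m}\mathbb B_1$ is a projective resolution of ${}_{\psi^m}\Lambda_1$. Let $\eta$ be a homogeneous element of degree $tm$, represented by a cocycle, that is,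 a bimodule homomorphism $f_\eta\colon {}_{\psi^m}B^{tm}_1\to\Lambda$. (1) Suppose that for some $n\ge 1$ $$f_\eta(\psi^{-n}(\lambda_0)\otimes\cdots\otimes\psi^{-n}(\lambda_{tm})\otimes 1)=\psi^{-n}\bigl(f_\eta(\lambda_0\otimes\cdots\otimes\lambda_{tm}\otimes 1)\bigr)\quad\text{for all }\lambda_0,\dots,\lambda_{tm}\in\Lambda.$$ Then $\eta_{\psi^{-n}}={}_{\psi^n}\eta$ in $\mathrm{Ext}^{tm}_{\Lambda^{e}}({}_{\psi^{m+n}}\Lambda_1,{}_{\psi^n}\Lambda_1)$, where $\eta_{\psi^{-n}}\in\mathrm{Ext}^{tm}_{\Lambda^{e}}({}_{\psi^m}\Lambda_{\psi^{-n}},{}_1\Lambda_{\psi^{-n}})$ is transported along the bimodule isomorphisms $\psi^{-n}\colon{}_{\psi^{m+n}}\Lambda_1\to{}_{\psi^m}\Lambda_{\psi^{-n}}$ and $\psi^{n}\colon{}_1\Lambda_{\psi^{-n}}\to{}_{\psi^n}\Lambda_1$. Consequently $\eta\theta=(-1)^{|\eta||\theta|}\theta\eta$ for every homogeneous element $\theta$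 of $\mathrm{HH}^{t*}({}_{\psi^*}\Lambda_1,\Lambda)$ such that $tn$ divides $|\theta|$. (2) In particular, if the condition in (1) holds for $n=1$, then $\eta$ belongs to the graded center of $\mathrm{HH}^{t*}({}_{\psi^*}\Lambda_1,\Lambda)$, that is, the subring generated by the homogeneous elements $z$ with $zy=(-1)^{|z||y|}yz$ for all homogeneous $y$. -/

import Mathlib

universe u v

open CategoryTheory CategoryTheory.Abelian
open scoped TensorProduct DirectSum

noncomputable section

namespace TwistedHochschild

section Bimodules

variable (k : Type u) [CommRing k] (Λ : Type v) [Ring Λ] [Algebra k Λ]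

/-- The enveloping algebra `Λ ⊗ₖ Λᵒᵖ`. -/
abbrev Env : Type v := Λ ⊗[k] Λᵐᵒᵖ

/-- The category of `Λ`-`Λ`-bimodules on which `k` acts centrally, that is, of left modules over
the enveloping algebra; `a · x · b` is `(a ⊗ₜ op b) • x`. -/
abbrev Bimod : Type (v + 1) := ModuleCat.{v} (Env k Λ)

/-- The bimodule `Λ`, with `(a ⊗ₜ op b) • x = a * x * b`. -/
def regular : Bimod k Λ :=
  @ModuleCat.of (Env k Λ) _ Λ _ (instModuleTensorProductMop k Λ)

variable {k Λ}

lemma regular_smul (a b : Λ) (x : regular k Λ) :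
    (a ⊗ₜ[k] MulOpposite.op b : Env k Λ) • x = (a * (show Λ from x) * b : Λ) :=
  AlgHom.mulLeftRight_apply k Λ a (MulOpposite.op b) x

/-- The bimodule twist: `(twist φ ρ).obj X` is `X` with the new actions
`a · x · b = φ a · x · ρ b`. -/
abbrev twist (φ ρ : Λ ≃ₐ[k] Λ) : Bimod k Λ ⥤ Bimod k Λ :=
  ModuleCat.restrictScalars
    (Algebra.TensorProduct.congr φ (AlgEquiv.op ρ)).toRingEquiv.toRingHom

lemma twist_smul (φ ρ : Λ ≃ₐ[k] Λ) (X : Bimod k Λ) (a b : Λ) (x : (twist φ ρ).obj X) :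
    (a ⊗ₜ[k] MulOpposite.op b : Env k Λ) • x =
      (φ a ⊗ₜ[k] MulOpposite.op (ρ b) : Env k Λ) • (show X from x) := rfl

/-- Induction on pure tensors in the enveloping algebra. -/
lemma env_induction {p : Env k Λ → Prop} (e : Env k Λ) (h0 : p 0)
    (h1 : ∀ a b : Λ, p (a ⊗ₜ MulOpposite.op b)) (h2 : ∀ x y, p x → p y → p (x + y)) : p e :=
  TensorProduct.induction_on e h0 (fun a b => h1 a b.unop) h2

/-- A bijective additive map compatible with the two-sided actions is an isomorphism of
bimodules. -/
def isoMk {X Y : Bimod k Λ} (e : X ≃+ Y)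
    (h : ∀ (a b : Λ) (x : X), e ((a ⊗ₜ[k] MulOpposite.op b : Env k Λ) • x) =
      (a ⊗ₜ[k] MulOpposite.op b : Env k Λ) • e x) : X ≅ Y :=
  LinearEquiv.toModuleIso
    { e with
      map_smul' := fun r x => by
        induction r using env_induction with
        | h0 =>
          exact ((congrArg e (zero_smul (Env k Λ) x)).trans e.map_zero).trans
            (zero_smul (Env k Λ) (e x)).symm
        | h1 a b => exact h a b x
        | h2 r s hr hs =>
          exact ((congrArg e (add_smul r s x)).trans (e.map_add _ _)).trans
            ((congrArg₂ (· + ·) hr hs).trans (add_smul r s (e x)).symm) }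

end Bimodules

section Bar

variable {k : Type u} [CommRing k] {Λ : Type v} [Ring Λ] [Algebra k Λ]

/-- The `k`-module underlying a bimodule. -/
abbrev kModule (X : Bimod k Λ) : Module k X := Module.compHom X (algebraMap k (Env k Λ))

attribute [local instance] kModule

local instance kTower (X : Bimod k Λ) : IsScalarTower k (Env k Λ) X :=
  ⟨fun c e x => by
    exact (congrArg (· • x) (Algebra.smul_def c e)).trans (mul_smul (algebraMap k _ c) e x)⟩

/-- The operator `x ↦ e • x` of an element of the enveloping algebra on a bimodule. -/
def opLin (X : Bimod k Λ) : Env k Λ →ₐ[k] Module.End k X := Algebra.lsmul k k X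

lemma opLin_apply (X : Bimod k Λ) (e : Env k Λ) (x : X) : opLin X e x = e • x := rfl

/-- The actions `a · (c ⊗ x) · b = (a * c) ⊗ (x · b)` of `Λ` on `Λ ⊗ₖ X`. -/
def barAction (X : Bimod k Λ) : Env k Λ →ₐ[k] Module.End k (Λ ⊗[k] X) :=
  Algebra.TensorProduct.lift
    ((Module.End.rTensorAlgHom k Λ X).comp (Algebra.lmul k Λ))
    ((Module.End.lTensorAlgHom k X Λ).comp
      ((opLin X).comp Algebra.TensorProduct.includeRight))
    (fun a b => by
      refine TensorProduct.ext' fun c x => ?_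
      rfl)

/-- The bimodule `Λ ⊗ₖ X`, with left action on the factor `Λ` and right action on the
factor `X`. -/
def barStep (X : Bimod k Λ) : Bimod k Λ :=
  @ModuleCat.of (Env k Λ) _ (Λ ⊗[k] X) _ (Module.compHom _ (barAction X).toRingHom)

/-- The pure tensor `c ⊗ x` in `Λ ⊗ₖ X`. -/
def barStepTmul {X : Bimod k Λ} (c : Λ) (x : X) : barStep X := (c ⊗ₜ[k] x : Λ ⊗[k] X)

lemma barStep_smul {X : Bimod k Λ} (a b c : Λ) (x : X) :
    (a ⊗ₜ[k] MulOpposite.op b : Env k Λ) • barStepTmul c x =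
      barStepTmul (a * c) ((1 ⊗ₜ[k] MulOpposite.op b : Env k Λ) • x) := by
  change barAction X (a ⊗ₜ[k] MulOpposite.op b) (c ⊗ₜ[k] x) = _
  simp only [barAction]
  rfl

/-- Induction on pure tensors. -/
lemma barStep_induction {X : Bimod k Λ} {p : barStep X → Prop} (z : barStep X) (h0 : p 0)
    (h1 : ∀ c x, p (barStepTmul c x)) (h2 : ∀ x y, p x → p y → p (x + y)) : p z :=
  TensorProduct.induction_on (R := k) (M := Λ) (N := X) z h0 h1 h2

lemma barAction_compat {X Y : Bimod k Λ} (g : Λ ⊗[k] X →ₗ[k] Y)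
    (h : ∀ (a b c : Λ) (x : X), g ((a * c) ⊗ₜ ((1 ⊗ₜ[k] MulOpposite.op b : Env k Λ) • x)) =
      (a ⊗ₜ[k] MulOpposite.op b : Env k Λ) • g (c ⊗ₜ x)) (r : Env k Λ) (z : Λ ⊗[k] X) :
    g (barAction X r z) = r • g z := by
  induction r using env_induction with
  | h0 =>
    simp only [map_zero, LinearMap.zero_apply]
    exact (zero_smul (Env k Λ) (g z)).symm
  | h1 a b =>
    induction z with
    | zero => simp only [map_zero, smul_zero]
    | add x y hx hy => simp only [map_add, smul_add, hx, hy]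
    | tmul c x => exact (congrArg g (barStep_smul a b c x)).trans (h a b c x)
  | h2 r s hr hs => simp only [map_add, LinearMap.add_apply, hr, hs, add_smul]

/-- A `k`-linear map out of `Λ ⊗ₖ X` that respects the actions on pure tensors is a morphism of
bimodules. -/
def barStepHom {X Y : Bimod k Λ} (g : Λ ⊗[k] X →ₗ[k] Y)
    (h : ∀ (a b c : Λ) (x : X), g ((a * c) ⊗ₜ ((1 ⊗ₜ[k] MulOpposite.op b : Env k Λ) • x)) =
      (a ⊗ₜ[k] MulOpposite.op b : Env k Λ) • g (c ⊗ₜ x)) : barStep X ⟶ Y :=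
  ModuleCat.ofHom (X := barStep X) (Y := Y)
    { toFun := fun z => g z
      map_add' := g.map_add
      map_smul' := barAction_compat g h }

lemma barStepHom_tmul {X Y : Bimod k Λ} (g : Λ ⊗[k] X →ₗ[k] Y) (h) (c : Λ) (x : X) :
    (barStepHom g h).hom (barStepTmul c x) = g (c ⊗ₜ x) := rfl

/-- The left action `Λ ⊗ₖ X ⟶ X`, `c ⊗ x ↦ c · x`. -/
def act (X : Bimod k Λ) : barStep X ⟶ X :=
  barStepHom
    (TensorProduct.lift ((opLin X).comp Algebra.TensorProduct.includeLeft).toLinearMap)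
    (fun a b c x => by
      change ((a * c) ⊗ₜ[k] 1 : Env k Λ) • (1 ⊗ₜ[k] MulOpposite.op b : Env k Λ) • x =
        (a ⊗ₜ[k] MulOpposite.op b : Env k Λ) • (c ⊗ₜ[k] 1 : Env k Λ) • x
      simp only [smul_smul, Algebra.TensorProduct.tmul_mul_tmul, one_mul, mul_one])

lemma act_tmul (X : Bimod k Λ) (c : Λ) (x : X) :
    (act X).hom (barStepTmul c x) = (c ⊗ₜ[k] MulOpposite.op 1 : Env k Λ) • x := rfl

/-- A morphism of bimodules, as a `k`-linear map. -/
def homLin {X Y : Bimod k Λ} (g : X ⟶ Y) : X →ₗ[k] Y where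
  toFun := g.hom
  map_add' := g.hom.map_add
  map_smul' c x := g.hom.map_smul (algebraMap k (Env k Λ) c) x

/-- The morphism `Λ ⊗ₖ X ⟶ Λ ⊗ₖ Y`, `c ⊗ x ↦ c ⊗ g x`. -/
def barStepMap {X Y : Bimod k Λ} (g : X ⟶ Y) : barStep X ⟶ barStep Y :=
  @barStepHom k _ Λ _ _ X (barStep Y)
    { toFun := (homLin g).lTensor Λ
      map_add' := ((homLin g).lTensor Λ).map_add
      map_smul' := fun c z => by
        refine (((homLin g).lTensor Λ).map_smul c z).trans ?_
        change _ = barAction Y (algebraMap k (Env k Λ) c) _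
        rw [AlgHom.commutes]
        rfl }
    (fun a b c x => by
      refine Eq.trans ?_ (barStep_smul a b c (g.hom x)).symm
      exact congrArg (barStepTmul (a * c)) (g.hom.map_smul _ x))

lemma barStepMap_tmul {X Y : Bimod k Λ} (g : X ⟶ Y) (c : Λ) (x : X) :
    (barStepMap g).hom (barStepTmul c x) = barStepTmul c (g.hom x) := rfl

/-- `barTower n` is the `(n + 1)`-fold tensor product of `Λ` over `k`, as a bimodule via the
outer factors. -/
def barTower (k : Type u) [CommRing k] (Λ : Type v) [Ring Λ] [Algebra k Λ] : ℕ → Bimod k Λ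
  | 0 => regular k Λ
  | n + 1 => barStep (barTower k Λ n)

/-- The element `c ⊗ x`. -/
abbrev barTmul {n : ℕ} (c : Λ) (x : barTower k Λ n) : barTower k Λ (n + 1) := barStepTmul c x

/-- The element `l 0 ⊗ l 1 ⊗ ⋯ ⊗ l n`. -/
def pure (k : Type u) [CommRing k] {Λ : Type v} [Ring Λ] [Algebra k Λ] :
    (n : ℕ) → (Fin (n + 1) → Λ) → barTower k Λ n
  | 0, l => l 0
  | n + 1, l => barTmul (l 0) (pure k n (fun i => l i.succ))

/-- The differentials of the augmented bar complex. On `Λ ⊗ₖ Λ` this is the multiplication, and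
then `δ (c ⊗ x) = c · x - c ⊗ δ x`; see `barDelta_pure` for the usual formula. -/
def barDelta (k : Type u) [CommRing k] (Λ : Type v) [Ring Λ] [Algebra k Λ] :
    (n : ℕ) → (barTower k Λ (n + 1) ⟶ barTower k Λ n)
  | 0 => act (regular k Λ)
  | n + 1 => Sub.sub (α := barTower k Λ (n + 2) ⟶ barTower k Λ (n + 1))
      (act (barTower k Λ (n + 1))) (barStepMap (barDelta k Λ n))

lemma barDelta_zero_tmul (c : Λ) (x : regular k Λ) :
    (barDelta k Λ 0).hom (barTmul (n := 0) c x) =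
      (c ⊗ₜ[k] MulOpposite.op 1 : Env k Λ) • x := rfl

lemma barDelta_succ_tmul (n : ℕ) (c : Λ) (x : barTower k Λ (n + 1)) :
    (barDelta k Λ (n + 1)).hom (barTmul c x) =
      (c ⊗ₜ[k] MulOpposite.op 1 : Env k Λ) • x - barTmul c ((barDelta k Λ n).hom x) := rfl

lemma smul_pure (n : ℕ) (a : Λ) (l : Fin (n + 1) → Λ) :
    (a ⊗ₜ[k] MulOpposite.op 1 : Env k Λ) • pure k n l =
      pure k n (Function.update l 0 (a * l 0)) := by
  cases n with
  | zero =>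
    refine (regular_smul a 1 (l 0)).trans ?_
    rw [mul_one]
    exact (Function.update_self (0 : Fin 1) (a * l 0) l).symm
  | succ n =>
    refine (barStep_smul a 1 (l 0) _).trans ?_
    have : (1 ⊗ₜ[k] MulOpposite.op 1 : Env k Λ) = 1 := rfl
    rw [this, one_smul]
    simp [pure]

lemma barStepTmul_add {X : Bimod k Λ} (c : Λ) (x y : X) :
    barStepTmul c (x + y) = barStepTmul c x + barStepTmul c y :=
  TensorProduct.tmul_add c x y

/-- The map `x ↦ c ⊗ x`. -/
def tmulHom (n : ℕ) (c : Λ) : barTower k Λ n →+ barTower k Λ (n + 1) where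
  toFun := barTmul c
  map_zero' := TensorProduct.tmul_zero _ c
  map_add' := barStepTmul_add c

/-- The usual formula for the bar differential:
`l₀ ⊗ ⋯ ⊗ lₙ₊₁ ↦ ∑ i ≤ n, (-1)^i l₀ ⊗ ⋯ ⊗ lᵢ lᵢ₊₁ ⊗ ⋯ ⊗ lₙ₊₁`. -/
theorem barDelta_pure (n : ℕ) (l : Fin (n + 2) → Λ) :
    (barDelta k Λ n).hom (pure k (n + 1) l) =
      ∑ i : Fin (n + 1), (-1 : ℤ) ^ (i : ℕ) •
        pure k n (fun j => Fin.contractNth i.castSucc (· * ·) l j) := by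
  induction n with
  | zero =>
    refine (barDelta_zero_tmul (k := k) (l 0) (l 1)).trans ?_
    refine (regular_smul (l 0) 1 (l 1)).trans ?_
    rw [mul_one, Fin.sum_univ_one]
    exact (one_smul ℤ (l 0 * l 1)).symm
  | succ n ih =>
    refine (barDelta_succ_tmul n (l 0) _).trans ?_
    have h := map_sum (tmulHom n (l 0)) (fun i : Fin (n + 1) =>
      (-1 : ℤ) ^ (i : ℕ) • pure k n (fun j => Fin.contractNth i.castSucc (· * ·)
        (fun i => l i.succ) j)) Finset.univ
    rw [ih, smul_pure]
    refine (congrArg₂ (· - ·) rfl h).trans (Eq.trans ?_ (Fin.sum_univ_succ _).symm)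
    rw [sub_eq_add_neg, ← Finset.sum_neg_distrib]
    congr 1
    · simp only [Fin.val_zero, pow_zero, one_smul]
      congr 1
      ext j
      refine Fin.cases ?_ (fun j => ?_) j <;> simp [Fin.contractNth]
    · refine Finset.sum_congr rfl fun i _ => ?_
      rw [map_zsmul, Fin.val_succ, pow_succ, mul_neg_one, neg_smul]
      congr 2
      change barTmul _ _ = barTmul _ _
      congr 2
      ext j
      simp [Fin.contractNth]

/-- Induction on the elements `c ⊗ x` of a step of the tower. -/
lemma barTower_induction {n : ℕ} {p : barTower k Λ (n + 1) → Prop} (z : barTower k Λ (n + 1))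
    (h0 : p 0) (h1 : ∀ c x, p (barTmul c x)) (h2 : ∀ x y, p x → p y → p (x + y)) : p z :=
  barStep_induction (X := barTower k Λ n) z h0 h1 h2

lemma barDelta_smul (n : ℕ) (e : Env k Λ) (x : barTower k Λ (n + 1)) :
    (barDelta k Λ n).hom (e • x) = e • (barDelta k Λ n).hom x := map_smul _ e x

lemma barDelta_barDelta (n : ℕ) (z : barTower k Λ (n + 2)) :
    (barDelta k Λ n).hom ((barDelta k Λ (n + 1)).hom z) = 0 := by
  induction n with
  | zero =>
    induction z using barTower_induction with
    | h0 => simp only [map_zero]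
    | h1 c x =>
      rw [barDelta_succ_tmul, map_sub, barDelta_smul]
      exact sub_eq_zero.2 (barDelta_zero_tmul c _).symm
    | h2 x y hx hy => rw [map_add, map_add, hx, hy, add_zero]
  | succ n ih =>
    induction z using barTower_induction with
    | h0 => simp only [map_zero]
    | h1 c x =>
      rw [barDelta_succ_tmul, map_sub, barDelta_smul, barDelta_succ_tmul, ih]
      exact (congrArg _ (congrArg _ (map_zero (tmulHom n c)))).trans
        (by rw [sub_zero, sub_self])
    | h2 x y hx hy => rw [map_add, map_add, hx, hy, add_zero]

lemma barDelta_comp (n : ℕ) : barDelta k Λ (n + 1) ≫ barDelta k Λ n = 0 := by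
  ext z
  exact barDelta_barDelta n z

lemma barDelta_zero_one_tmul (x : regular k Λ) :
    (barDelta k Λ 0).hom (barTmul (n := 0) 1 x) = x := by
  rw [barDelta_zero_tmul]
  exact one_smul (Env k Λ) x

lemma barDelta_one_tmul (n : ℕ) (x : barTower k Λ (n + 1)) :
    (barDelta k Λ (n + 1)).hom (barTmul 1 x) =
      x - barTmul 1 ((barDelta k Λ n).hom x) := by
  rw [barDelta_succ_tmul]
  exact congrArg (· - _) (one_smul (Env k Λ) x)

lemma barDelta_exact (n : ℕ) (x : barTower k Λ (n + 1)) (hx : (barDelta k Λ n).hom x = 0) :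
    ∃ y, (barDelta k Λ (n + 1)).hom y = x := by
  refine ⟨barTmul 1 x, ?_⟩
  rw [barDelta_one_tmul, hx]
  exact (congrArg _ (map_zero (tmulHom n (1 : Λ)))).trans (sub_zero x)

/-- The right `Λ`-module underlying a bimodule. -/
abbrev rightModule (X : Bimod k Λ) : Module Λᵐᵒᵖ X :=
  Module.compHom X
    (Algebra.TensorProduct.includeRight : Λᵐᵒᵖ →ₐ[k] Env k Λ).toRingHom

attribute [local instance] rightModule

local instance rightTower (X : Bimod k Λ) : IsScalarTower k Λᵐᵒᵖ X :=
  ⟨fun c e x => by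
    change ((1 : Λ) ⊗ₜ[k] (c • e) : Env k Λ) • x =
      algebraMap k (Env k Λ) c • ((1 : Λ) ⊗ₜ[k] e : Env k Λ) • x
    have h : ((1 : Λ) ⊗ₜ[k] (c • e) : Env k Λ) = algebraMap k (Env k Λ) c * (1 ⊗ₜ e) :=
      (TensorProduct.tmul_smul c (1 : Λ) e).trans (Algebra.smul_def (A := Env k Λ) c _)
    rw [h, mul_smul]⟩

lemma projective_right_regular :
    Module.Projective Λᵐᵒᵖ (regular k Λ) := by
  refine Module.Projective.of_equiv' (R := Λᵐᵒᵖ) (M := Λᵐᵒᵖ) ?_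
  exact
    { toFun := fun b => (b.unop : Λ)
      invFun := fun x => MulOpposite.op (show Λ from x)
      left_inv := fun _ => rfl
      right_inv := fun _ => rfl
      map_add' := fun _ _ => rfl
      map_smul' := fun c x =>
        ((regular_smul 1 c.unop (x.unop : Λ)).trans (by rw [one_mul]; rfl)).symm }

lemma projective_right_barStep [Module.Projective k Λ] (X : Bimod k Λ)
    (hX : Module.Projective Λᵐᵒᵖ X) : Module.Projective Λᵐᵒᵖ (barStep X) := by
  have : Module.Projective Λᵐᵒᵖ (X ⊗[k] Λ) := inferInstance
  refine Module.Projective.of_equiv' (R := Λᵐᵒᵖ) (M := X ⊗[k] Λ) ?_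
  exact
    { toFun := fun z => (TensorProduct.comm k X Λ z : Λ ⊗[k] X)
      invFun := fun z => (TensorProduct.comm k X Λ).symm z
      left_inv := (TensorProduct.comm k X Λ).left_inv
      right_inv := (TensorProduct.comm k X Λ).right_inv
      map_add' := (TensorProduct.comm k X Λ).map_add
      map_smul' := fun b z => by
        induction z with
        | zero =>
          refine (congrArg _ (smul_zero b)).trans ?_
          refine (map_zero (TensorProduct.comm k X Λ)).trans ?_
          refine Eq.trans ?_ (congrArg _ (map_zero (TensorProduct.comm k X Λ)).symm)
          exact (smul_zero (A := barStep X) b).symm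
        | add x y hx hy =>
          refine (congrArg _ (smul_add b x y)).trans ?_
          refine (map_add (TensorProduct.comm k X Λ) _ _).trans ?_
          refine Eq.trans ?_ (congrArg _ (map_add (TensorProduct.comm k X Λ) x y).symm)
          exact (congrArg₂ (· + ·) hx hy).trans (smul_add (A := barStep X) b _ _).symm
        | tmul x c =>
          refine Eq.trans ?_ (barStep_smul 1 b.unop c x).symm
          rw [one_mul]
          rfl }

lemma projective_barStep (X : Bimod k Λ) (hX : Module.Projective Λᵐᵒᵖ X) :
    Projective (barStep X) := by
  refine ⟨fun {Z Y} f e he => ?_⟩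
  have hs := (ModuleCat.epi_iff_surjective e).mp he
  let e' : Z →ₗ[Λᵐᵒᵖ] Y :=
    { toFun := e.hom
      map_add' := e.hom.map_add
      map_smul' := fun b y => e.hom.map_smul _ y }
  let f' : X →ₗ[Λᵐᵒᵖ] Y :=
    { toFun := fun x => f.hom (barStepTmul 1 x)
      map_add' := fun x y =>
        (congrArg f.hom (barStepTmul_add 1 x y)).trans (f.hom.map_add _ _)
      map_smul' := fun b x => by
        have h := barStep_smul 1 b.unop 1 x
        rw [one_mul] at h
        exact (congrArg f.hom h.symm).trans (f.hom.map_smul _ _) }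
  obtain ⟨g, hg⟩ := Module.projective_lifting_property e' f' hs
  let g' : X →ₗ[k] Z :=
    { toFun := g
      map_add' := g.map_add
      map_smul' := fun c x => by
        have h1 : ∀ (W : Bimod k Λ) (w : W), c • w = (c • (1 : Λᵐᵒᵖ)) • w := fun W w => by
          rw [smul_assoc, one_smul]
        rw [h1 X, g.map_smul, RingHom.id_apply, h1 Z] }
  let G : Λ ⊗[k] X →ₗ[k] Z :=
    TensorProduct.lift
      ((LinearMap.lcomp k Z g').comp
        ((opLin Z).comp Algebra.TensorProduct.includeLeft).toLinearMap)
  have hG : ∀ c x, G (c ⊗ₜ x) = (c ⊗ₜ[k] MulOpposite.op 1 : Env k Λ) • g x := fun c x => rfl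
  refine ⟨barStepHom G fun a b c x => ?_, ?_⟩
  · have h2 : g ((1 ⊗ₜ[k] MulOpposite.op b : Env k Λ) • x) =
        (1 ⊗ₜ[k] MulOpposite.op b : Env k Λ) • g x := g.map_smul (MulOpposite.op b) x
    rw [hG, hG, h2]
    simp only [smul_smul, Algebra.TensorProduct.tmul_mul_tmul, one_mul, mul_one,
      MulOpposite.op_one]
  · ext z
    induction z using barStep_induction with
    | h0 => simp only [map_zero]
    | h1 c x =>
      have h3 : e.hom (g x) = f.hom (barStepTmul 1 x) := LinearMap.congr_fun hg x
      change e.hom (G (c ⊗ₜ x)) = _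
      rw [hG, map_smul, h3, ← map_smul, barStep_smul, mul_one]
      exact congrArg (fun y => f.hom (barStepTmul c y)) (one_smul (Env k Λ) x)
    | h2 x y hx hy => rw [map_add, map_add, hx, hy]

lemma projective_barTower [Module.Projective k Λ] (n : ℕ) :
    Module.Projective Λᵐᵒᵖ (barTower k Λ n) := by
  induction n with
  | zero => exact projective_right_regular
  | succ n ih => exact projective_right_barStep _ ih

variable (k Λ)

/-- The bar complex `⋯ ⟶ B² ⟶ B¹ ⟶ B⁰`, where `Bⁿ` is the `(n + 2)`-fold tensor product of `Λ`. -/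
def barComplex : ChainComplex (Bimod k Λ) ℕ :=
  ChainComplex.of (fun n => barTower k Λ (n + 1)) (fun n => barDelta k Λ (n + 1))
    (fun n => barDelta_comp (n + 1))

lemma barComplex_d (n : ℕ) : (barComplex k Λ).d (n + 1) n = barDelta k Λ (n + 1) :=
  ChainComplex.of_d (fun n => barTower k Λ (n + 1)) (fun n => barDelta k Λ (n + 1)) n

/-- The augmentation of the bar complex by the multiplication `B⁰ = Λ ⊗ₖ Λ ⟶ Λ`. -/
def barAugmentation : barComplex k Λ ⟶ (ChainComplex.single₀ (Bimod k Λ)).obj (regular k Λ) :=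
  (ChainComplex.toSingle₀Equiv (barComplex k Λ) (regular k Λ)).symm
    ⟨barDelta k Λ 0, (congrArg (· ≫ barDelta k Λ 0) (barComplex_d k Λ 0)).trans (barDelta_comp 0)⟩

lemma barAugmentation_f_zero : (barAugmentation k Λ).f 0 = barDelta k Λ 0 :=
  ChainComplex.toSingle₀Equiv_symm_apply_f_zero _ _

lemma quasiIso_barAugmentation : QuasiIso (barAugmentation k Λ) := ⟨fun n => by
  cases n with
  | zero =>
    rw [ChainComplex.quasiIsoAt₀_iff, ShortComplex.quasiIso_iff_of_zeros' _ rfl rfl rfl]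
    refine (ShortComplex.exact_and_epi_g_iff_of_iso
      (S₂ := ShortComplex.mk (barDelta k Λ 1) (barDelta k Λ 0) (barDelta_comp 0)) ?_).2 ⟨?_, ?_⟩
    · refine ShortComplex.isoMk (Iso.refl _) (Iso.refl _) (Iso.refl _) ?_ ?_
      · exact (Category.id_comp _).trans ((barComplex_d k Λ 0).symm.trans (Category.comp_id _).symm)
      · exact (Category.id_comp _).trans
          ((barAugmentation_f_zero k Λ).symm.trans (Category.comp_id _).symm)
    · exact (ShortComplex.moduleCat_exact_iff _).2 (barDelta_exact 0)
    · exact (ModuleCat.epi_iff_surjective _).2 fun x => ⟨_, barDelta_zero_one_tmul x⟩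
  | succ n =>
    rw [quasiIsoAt_iff_exactAt' _ _ (ChainComplex.exactAt_succ_single_obj _ _),
      HomologicalComplex.exactAt_iff' _ (n + 1 + 1) (n + 1) n (by simp) (by simp)]
    refine (ShortComplex.moduleCat_exact_iff _).2 ?_
    have h1 := barComplex_d k Λ n
    have h2 := barComplex_d k Λ (n + 1)
    intro x hx
    have hx' : (barDelta k Λ (n + 1)).hom x = 0 :=
      (congrArg (fun g => ModuleCat.Hom.hom g x) h1).symm.trans hx
    obtain ⟨y, hy⟩ := barDelta_exact (n + 1) x hx'
    exact ⟨y, (congrArg (fun g => ModuleCat.Hom.hom g y) h2).trans hy⟩⟩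

/-- The bar resolution of the bimodule `Λ`. -/
def barResolution [Module.Projective k Λ] : ProjectiveResolution (regular k Λ) where
  complex := barComplex k Λ
  projective n := projective_barStep _ (projective_barTower n)
  π := barAugmentation k Λ
  quasiIso := quasiIso_barAugmentation k Λ

end Bar

section Cohomology

variable {k : Type u} [CommRing k] {Λ : Type v} [Ring Λ] [Algebra k Λ]

/-- The bimodule `Λ` with left action twisted by `ψ ^ n`: `a · x · b = (ψ ^ n) a * x * b`. -/
def twisted (ψ : Λ ≃ₐ[k] Λ) (n : ℕ) : Bimod k Λ := (twist (ψ ^ n) 1).obj (regular k Λ)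

lemma twisted_smul (ψ : Λ ≃ₐ[k] Λ) (n : ℕ) (a b : Λ) (x : twisted ψ n) :
    (a ⊗ₜ[k] MulOpposite.op b : Env k Λ) • x = ((ψ ^ n) a * (show Λ from x) * b : Λ) :=
  regular_smul ((ψ ^ n) a) b x

/-- The component of degree `t * n` of the twisted Hochschild cohomology: the group
`Ext ^ (t * n)` over the enveloping algebra, from `Λ` twisted by `ψ ^ n` on the left, to `Λ`. -/
def HHDeg (ψ : Λ ≃ₐ[k] Λ) (t n : ℕ) : Type v :=
  Ext.{v} (twisted ψ n) (regular k Λ) (t * n)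

instance (ψ : Λ ≃ₐ[k] Λ) (t n : ℕ) : AddCommGroup (HHDeg ψ t n) :=
  inferInstanceAs (AddCommGroup (Ext.{v} (twisted ψ n) (regular k Λ) (t * n)))

/-- Twisting on the left by `ψ ^ m` and by `ψ ^ n` amounts to twisting by `ψ ^ (n + m)`; the
underlying map is the identity. -/
def twistedAddIso (ψ : Λ ≃ₐ[k] Λ) (n m : ℕ) :
    twisted ψ (n + m) ≅ (twist (ψ ^ n) 1).obj (twisted ψ m) :=
  isoMk (AddEquiv.refl Λ) fun a b x => by
    refine (twisted_smul ψ (n + m) a b x).trans ?_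
    refine Eq.trans ?_ (twisted_smul ψ m ((ψ ^ n) a) b x).symm
    rw [add_comm, pow_add]
    rfl

/-- The isomorphism `x ↦ ψ⁻ⁿ x` from `Λ` with left action twisted by `ψ ^ (n + m)` to `Λ` with
left action twisted by `ψ ^ m` and right action twisted by `ψ⁻ⁿ`. -/
def twistedInvIso (ψ : Λ ≃ₐ[k] Λ) (n m : ℕ) :
    twisted ψ (n + m) ≅ (twist 1 (ψ ^ n)⁻¹).obj (twisted ψ m) :=
  isoMk (((ψ ^ n)⁻¹ : Λ ≃ₐ[k] Λ) : Λ ≃+ Λ) fun a b x => by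
    refine (congrArg (fun y : Λ => (ψ ^ n)⁻¹ y) (twisted_smul ψ (n + m) a b x)).trans ?_
    refine Eq.trans ?_ (twisted_smul ψ m a ((ψ ^ n)⁻¹ b) ((ψ ^ n)⁻¹ (show Λ from x))).symm
    rw [map_mul, map_mul, pow_add, ← AlgEquiv.mul_apply, inv_mul_cancel_left]

/-- The isomorphism `x ↦ ψⁿ x` from `Λ` with right action twisted by `ψ⁻ⁿ` to `Λ` with left
action twisted by `ψ ^ n`. -/
def regularTwistIso (ψ : Λ ≃ₐ[k] Λ) (n : ℕ) :
    (twist 1 (ψ ^ n)⁻¹).obj (regular k Λ) ≅ twisted ψ n :=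
  isoMk ((ψ ^ n : Λ ≃ₐ[k] Λ) : Λ ≃+ Λ) fun a b x => by
    refine (congrArg (fun y : Λ => (ψ ^ n) y) (regular_smul a ((ψ ^ n)⁻¹ b) x)).trans ?_
    refine Eq.trans ?_ (twisted_smul ψ n a b ((ψ ^ n) (show Λ from x))).symm
    rw [map_mul, map_mul, ← AlgEquiv.mul_apply _ _ b, mul_inv_cancel, AlgEquiv.one_apply]

/-- The left twist of `η` by `ψ ^ n`. -/
def leftTwist {ψ : Λ ≃ₐ[k] Λ} {t m : ℕ} (n : ℕ) (η : HHDeg ψ t m) :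
    Ext.{v} (twisted ψ (n + m)) (twisted ψ n) (t * m) :=
  (Ext.mk₀ (twistedAddIso ψ n m).hom).comp
    (Ext.mapExactFunctor (twist (ψ ^ n) 1) (X := twisted ψ m) (Y := regular k Λ) η) (zero_add _)

/-- The right twist of `η` by `ψ ^ (-n)`, read as an extension between the same bimodules as
`leftTwist n η` through the isomorphisms given by `ψ ^ (-n)` and `ψ ^ n`. -/
def rightTwist {ψ : Λ ≃ₐ[k] Λ} {t m : ℕ} (n : ℕ) (η : HHDeg ψ t m) :
    Ext.{v} (twisted ψ (n + m)) (twisted ψ n) (t * m) :=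
  ((Ext.mk₀ (twistedInvIso ψ n m).hom).comp
    (Ext.mapExactFunctor (twist 1 (ψ ^ n)⁻¹) (X := twisted ψ m) (Y := regular k Λ) η)
      (zero_add _)).comp (Ext.mk₀ (regularTwistIso ψ n).hom) (add_zero _)

/-- The product of homogeneous elements: the Yoneda product of `η` with the left twist of `θ` by
`ψ ^ m`, where `t * m` is the degree of `η`. -/
def hmul {ψ : Λ ≃ₐ[k] Λ} {t m l : ℕ} (η : HHDeg ψ t m) (θ : HHDeg ψ t l) : HHDeg ψ t (m + l) :=
  (leftTwist m θ).comp (Z := regular k Λ) η (by rw [mul_add, add_comm])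

lemma leftTwist_zero {ψ : Λ ≃ₐ[k] Λ} {t m : ℕ} (n : ℕ) :
    leftTwist n (0 : HHDeg ψ t m) = 0 := by
  refine (congrArg (fun e => (Ext.mk₀ (twistedAddIso ψ n m).hom).comp e (zero_add _))
    (Ext.mapExactFunctor_zero (twist (ψ ^ n) 1) _ _ _)).trans ?_
  exact Ext.comp_zero _ _ _ _ _

lemma leftTwist_add {ψ : Λ ≃ₐ[k] Λ} {t m : ℕ} (n : ℕ) (η θ : HHDeg ψ t m) :
    leftTwist n (η + θ) = leftTwist n η + leftTwist n θ := by
  refine (congrArg (fun e => (Ext.mk₀ (twistedAddIso ψ n m).hom).comp e (zero_add _))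
    (Ext.mapExactFunctor_add (twist (ψ ^ n) 1) _ _ _ η θ)).trans ?_
  exact Ext.comp_add _ _ _ _

instance (ψ : Λ ≃ₐ[k] Λ) (t : ℕ) : DirectSum.GNonUnitalNonAssocSemiring (HHDeg ψ t) where
  mul := hmul
  mul_zero η := by
    change (leftTwist _ 0).comp η _ = 0
    rw [leftTwist_zero]
    exact Ext.zero_comp (Z := regular k Λ) _ _ η _ _
  zero_mul θ := Ext.comp_zero _ _ _ _ _
  mul_add η θ₁ θ₂ := by
    change (leftTwist _ (θ₁ + θ₂)).comp η _ = _
    rw [leftTwist_add]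
    exact Ext.add_comp _ _ _ _
  add_mul η₁ η₂ θ := Ext.comp_add _ _ _ _

/-- The twisted Hochschild cohomology: the direct sum over `n ≥ 0` of the groups `HHDeg ψ t n`,
with the product determined by `hmul`. -/
abbrev HH (ψ : Λ ≃ₐ[k] Λ) (t : ℕ) : Type v := ⨁ n, HHDeg ψ t n

/-- An element of `HHDeg ψ t n` as a homogeneous element of `HH ψ t`. -/
abbrev homog {ψ : Λ ≃ₐ[k] Λ} {t n : ℕ} (η : HHDeg ψ t n) : HH ψ t := DirectSum.of (HHDeg ψ t) n η

lemma homog_mul {ψ : Λ ≃ₐ[k] Λ} {t m l : ℕ} (η : HHDeg ψ t m) (θ : HHDeg ψ t l) :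
    homog η * homog θ = homog (hmul η θ) := DirectSum.of_mul_of η θ

/-- The graded center: generated additively by the homogeneous elements that commute with every
homogeneous element up to the sign given by the product of the degrees. -/
def gradedCenter (ψ : Λ ≃ₐ[k] Λ) (t : ℕ) : AddSubgroup (HH ψ t) :=
  AddSubgroup.closure {z | ∃ (m : ℕ) (η : HHDeg ψ t m), z = homog η ∧
    ∀ (l : ℕ) (θ : HHDeg ψ t l),
      homog η * homog θ = (-1 : ℤ) ^ ((t * m) * (t * l)) • (homog θ * homog η)}

/-- The twist by `ψ ^ m` on the left of the bar resolution, a projective resolution of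
`twisted ψ m`. -/
def twistedBarResolution [Module.Projective k Λ] (ψ : Λ ≃ₐ[k] Λ) (m : ℕ) :
    ProjectiveResolution (twisted ψ m) :=
  (twist (ψ ^ m) 1).mapProjectiveResolution (barResolution k Λ)

/-- The bimodule `Bᴺ`, the `(N + 2)`-fold tensor product of `Λ`, with left action twisted by
`ψ ^ m`. -/
abbrev twistedBar (ψ : Λ ≃ₐ[k] Λ) (m N : ℕ) : Bimod k Λ :=
  (twist (ψ ^ m) 1).obj (barTower k Λ (N + 1))

/-- The bimodule homomorphism `f` is a cocycle on the twisted bar resolution that represents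
the class `η`. -/
def Represents [Module.Projective k Λ] {ψ : Λ ≃ₐ[k] Λ} {t m : ℕ}
    (f : twistedBar ψ m (t * m) ⟶ regular k Λ) (η : HHDeg ψ t m) : Prop :=
  ∃ hf : (twistedBarResolution ψ m).complex.d (t * m + 1) (t * m) ≫ f = 0,
    (twistedBarResolution ψ m).extMk f (t * m + 1) rfl hf = η

/-- The value `f (l 0 ⊗ ⋯ ⊗ l N ⊗ 1)`. -/
def evalOne {ψ : Λ ≃ₐ[k] Λ} {m N : ℕ} (f : twistedBar ψ m N ⟶ regular k Λ)
    (l : Fin (N + 1) → Λ) : Λ :=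
  f.hom (pure k (N + 1) (Fin.snoc (α := fun _ => Λ) l 1))

/-- The condition
`f (ψ⁻ⁿ l₀ ⊗ ⋯ ⊗ ψ⁻ⁿ l_N ⊗ 1) = ψ⁻ⁿ (f (l₀ ⊗ ⋯ ⊗ l_N ⊗ 1))` for all `l₀, …, l_N`. -/
def CommutesWithInvPow {ψ : Λ ≃ₐ[k] Λ} {m N : ℕ} (f : twistedBar ψ m N ⟶ regular k Λ)
    (n : ℕ) : Prop :=
  ∀ l : Fin (N + 1) → Λ,
    evalOne f (fun i => (ψ ^ n)⁻¹ (l i)) = (ψ ^ n)⁻¹ (evalOne f l)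

end Cohomology

end TwistedHochschild

end

/-! Two facts carry the theorem: the invariance of the cocycle identifies two twists of `η`, and `η`
extends to a family of classes, one for each bimodule, which is natural up to sign.

The first fact is a comparison of cocycles. Both twists are computed on the bar resolution twisted
by `ψ ^ (n + m)`: for the left twist the comparison map is the identity, for the right twist it is
`ψ⁻ⁿ` on every tensor factor. The two cocycles are then `f` and `ψⁿ ∘ f ∘ ψ⁻ⁿ`, which coincide by
hypothesis (`rightTwist_eq_leftTwist`, resting on `mk₀_comp_mapExactFunctor_extMk`).

For the second fact put `φ = ψ ^ m` and let `Ω X` be the kernel of the action `Λ ⊗ₖ X ⟶ X`. As `Λ`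
is projective over `k`, `Ω` is an exact functor and the bimodules `Λ ⊗ₖ Ωⁱ Λ` are projective, so `η`
comes from a morphism `h` from the twisted syzygy of `Λ` in degree `t * m` to `Λ`. In effect
tensoring `h` over `Λ` with `X` gives a morphism natural in `X` (`extend`), and composing it with
the splice of the sequences `0 ⟶ Ω ⟶ Λ ⊗ₖ - ⟶ 𝟭 ⟶ 0` gives `naturalClass h X`, a class from `X`
twisted on the left by `φ` to `X`, which is `η` at `X = Λ`. A class `θ` of degree `q` can be moved
past a connecting class at the cost of `(-1) ^ q`, by the anticommutativity of connecting classes in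
a 3×3 diagram (`extClass_comp_extClass_add`). This yields the graded naturality
`mapExactFunctor_comp_naturalClass`.

The family also commutes with right twists (`naturalClass_twist`). Since `ψˡ` identifies `Λ` twisted
by `ψ⁻ˡ` on the right with `Λ` twisted by `ψˡ` on the left, the family at the latter bimodule is the
right twist of `η`, hence by the first fact its left twist. Graded naturality applied to `θ` of
degree `t * l` then says precisely that `η` and `θ` commute up to sign. Invariance under `ψ⁻ⁿ` gives
invariance under `ψ⁻ˡ` for every multiple `l` of `n`. -/

noncomputable section

/-! ### Images under exact functors of `Ext` classes given by cocycles -/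

section MapExt

universe w w' u' v'

open Limits CochainComplex HomComplex

lemma CochainComplex.HomComplex.equivHomShift_v {C : Type u} [Category.{v} C] [Preadditive C]
    {K L : CochainComplex C ℤ} {n : ℤ} (f : K ⟶ L⟦n⟧) (p q : ℤ) (h : p + n = q) :
    (Cocycle.equivHomShift f).1.v p q h =
      f.f p ≫ (L.shiftFunctorObjXIso n p q h.symm).hom := by
  rw [Cocycle.equivHomShift_apply]
  refine (Cochain.rightUnshift_v _ _ (zero_add n) _ _ _ p (add_zero p)).trans ?_
  exact congrArg (· ≫ (L.shiftFunctorObjXIso n p q h.symm).hom) (Cochain.ofHom_v f p)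

lemma CochainComplex.HomComplex.equivHomShift_symm_f {C : Type u} [Category.{v} C] [Preadditive C]
    {K L : CochainComplex C ℤ} {n : ℤ} (z : Cocycle K L n) (p q : ℤ) (h : p + n = q) :
    (Cocycle.equivHomShift.symm z).f p ≫ (L.shiftFunctorObjXIso n p q h.symm).hom =
      z.1.v p q h := by
  rw [← equivHomShift_v, AddEquiv.apply_symm_apply]

/-- Once `q` is replaced by `p + n`, both shift isomorphisms are identities. -/
lemma CochainComplex.map_f_comp_shiftFunctorObjXIso_hom {C : Type u} [Category.{v} C]
    [Preadditive C] {D : Type u'} [Category.{v'} D] [Preadditive D] (F : C ⥤ D) [F.Additive]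
    {L : CochainComplex C ℤ} {L' : CochainComplex D ℤ}
    (s : (F.mapHomologicalComplex (ComplexShape.up ℤ)).obj L ⟶ L') {n : ℤ} (p q : ℤ)
    (h : p + n = q) :
    (s⟦n⟧').f p ≫ (L'.shiftFunctorObjXIso n p q h.symm).hom =
      F.map (L.shiftFunctorObjXIso n p q h.symm).hom ≫ s.f q := by
  subst h
  refine (Category.comp_id _).trans (Eq.trans ?_ (congrArg (· ≫ _) (F.map_id _).symm))
  exact (Category.id_comp _).symm

namespace CategoryTheory.ProjectiveResolution

variable {C : Type u} [Category.{v} C] [Abelian C] {D : Type u'} [Category.{v'} D] [Abelian D]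
  {F : C ⥤ D} [F.Additive] {X : C} {X' : D}

/-- A comparison from a projective resolution of `X'` to the image of a projective resolution of
`X` under a functor `F`, over a morphism `X' ⟶ F.obj X`. -/
structure MapHom (R' : ProjectiveResolution X') (R : ProjectiveResolution X) (F : C ⥤ D)
    (g : X' ⟶ F.obj X) where
  /-- The components of the comparison. -/
  f (i : ℕ) : R'.complex.X i ⟶ F.obj (R.complex.X i)
  comm (i : ℕ) : R'.complex.d (i + 1) i ≫ f i = f (i + 1) ≫ F.map (R.complex.d (i + 1) i)
  comm_π : (show R'.complex.X 0 ⟶ X' from R'.π.f 0) ≫ g =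
    f 0 ≫ F.map (show R.complex.X 0 ⟶ X from R.π.f 0)

namespace MapHom

variable {R' : ProjectiveResolution X'} {R : ProjectiveResolution X} {g : X' ⟶ F.obj X}
  (φ : MapHom R' R F g)

/-- The components of `MapHom.hom`. -/
def homF (i : ℤ) : R'.cochainComplex.X i ⟶ F.obj (R.cochainComplex.X i) :=
  -- The cochain complex of a resolution has the `k`-th term in degree `-k` and vanishes in positive
  -- degrees.
  if h : i ≤ 0 then
    (R'.cochainComplexXIso i i.natAbs (by lia)).hom ≫ φ.f i.natAbs ≫
      F.map (R.cochainComplexXIso i i.natAbs (by lia)).inv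
  else 0

-- Lets any `k` with `-k = i` stand for `i.natAbs`, so that consecutive degrees can be compared.
omit [F.Additive] in
lemma homF_eq (i : ℤ) (k : ℕ) (h : -k = i) :
    φ.homF i = (R'.cochainComplexXIso i k h).hom ≫ φ.f k ≫
        F.map (R.cochainComplexXIso i k h).inv := by
  obtain rfl : k = i.natAbs := by lia
  exact dif_pos (by lia)

lemma homF_comm (i : ℤ) :
    φ.homF i ≫ F.map (R.cochainComplex.d i (i + 1)) =
      R'.cochainComplex.d i (i + 1) ≫ φ.homF (i + 1) := by
  by_cases h : i + 1 ≤ 0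
  · obtain ⟨k, hk⟩ : ∃ k : ℕ, -(k : ℤ) = i + 1 := ⟨(i + 1).natAbs, by lia⟩
    rw [φ.homF_eq i (k + 1) (by lia), φ.homF_eq (i + 1) k hk,
      cochainComplex_d R' i (i + 1) (k + 1) k (by lia) hk,
      cochainComplex_d R i (i + 1) (k + 1) k (by lia) hk]
    simp only [Category.assoc, Iso.inv_hom_id_assoc, ← F.map_comp]
    rw [reassoc_of% (φ.comm k), F.map_comp]
  · refine (IsZero.eq_of_tgt ?_ _ _)
    exact F.map_isZero (isZero_of_isStrictlyLE R.cochainComplex 0 (i + 1) (by lia))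

/-- The morphism of cochain complexes given by a comparison of projective resolutions. -/
def hom : R'.cochainComplex ⟶
    (F.mapHomologicalComplex (ComplexShape.up ℤ)).obj R.cochainComplex where
  f i := φ.homF i
  comm' i j hij := by
    obtain rfl : i + 1 = j := hij
    exact φ.homF_comm i

/-- A morphism to a complex concentrated in degree 0 is determined by its component there, and that
component is `comm_π` up to structural isomorphisms. -/
lemma hom_comp_π' [PreservesFiniteLimits F] [PreservesFiniteColimits F] :
    φ.hom ≫ (F.mapHomologicalComplex (ComplexShape.up ℤ)).map R.π' ≫
      (F.mapCochainComplexSingleFunctor 0).hom.app X =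
        R'.π' ≫ (CochainComplex.singleFunctor D 0).map g := by
  refine HomologicalComplex.to_single_hom_ext ?_
  have h1 := HomologicalComplex.singleMapHomologicalComplex_hom_app_self F (.up ℤ) 0 X
  have h2 := HomologicalComplex.single_map_f_self (.up ℤ) 0 g
  have h3 : φ.homF 0 ≫ F.map (R.π'.f 0) ≫
      (F.map (HomologicalComplex.singleObjXSelf (.up ℤ) 0 X).hom ≫
        (HomologicalComplex.singleObjXSelf (.up ℤ) 0 (F.obj X)).inv) =
      R'.π'.f 0 ≫ (HomologicalComplex.singleObjXSelf (.up ℤ) 0 X').hom ≫ g ≫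
        (HomologicalComplex.singleObjXSelf (.up ℤ) 0 (F.obj X)).inv := by
    have h := φ.comm_π
    rw [φ.homF_eq 0 0 rfl, π'_f_zero, π'_f_zero]
    change _ ≫ F.map (_ ≫ (show R.complex.X 0 ⟶ X from R.π.f 0) ≫ _) ≫ _ =
      (_ ≫ (show R'.complex.X 0 ⟶ X' from R'.π.f 0) ≫ _) ≫ _
    generalize (show R.complex.X 0 ⟶ X from R.π.f 0) = p at h ⊢
    generalize (show R'.complex.X 0 ⟶ X' from R'.π.f 0) = p' at h ⊢
    -- The ends of these isomorphisms are only definitionally `X`, `X'` and `F.obj X`; generalizing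
    -- them allows `change` to restate their types so that `simp` can cancel them.
    generalize HomologicalComplex.singleObjXSelf (.up ℤ) 0 X = i1
    generalize HomologicalComplex.singleObjXSelf (.up ℤ) 0 X' = i2
    generalize HomologicalComplex.singleObjXSelf (.up ℤ) 0 (F.obj X) = i3
    revert i1 i2 i3
    change ∀ (i1 : X ≅ X) (i2 : X' ≅ X') (i3 : F.obj X ≅ F.obj X), _
    intro i1 i2 i3
    change (_ ≫ φ.f 0 ≫ _) ≫ F.map (_ ≫ p ≫ i1.inv) ≫ F.map i1.hom ≫ i3.inv =
      (_ ≫ p' ≫ i2.inv) ≫ i2.hom ≫ g ≫ i3.inv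
    simp only [Category.assoc, Iso.inv_hom_id_assoc, reassoc_of% h, ← F.map_comp_assoc,
      Iso.inv_hom_id, Category.comp_id]
  exact (congrArg (φ.homF 0 ≫ F.map (R.π'.f 0) ≫ ·) h1).trans
    (h3.trans (congrArg (R'.π'.f 0 ≫ ·) h2.symm))

/-- The identity of cocycles behind `mk₀_comp_mapExactFunctor_extMk`, at the level of complexes.
Since the target is concentrated in one degree, only the component in degree `-n` has content. -/
lemma equivHomShift_toSingleMk [PreservesFiniteLimits F] [PreservesFiniteColimits F] {Y : C}
    {n : ℕ} (f : R.complex.X n ⟶ Y) (m : ℕ) (hm : n + 1 = m) (hf : R.complex.d m n ≫ f = 0)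
    (hf' : R'.complex.d m n ≫ φ.f n ≫ F.map f = 0) :
    Cocycle.equivHomShift.symm
      (Cocycle.toSingleMk ((R'.cochainComplexXIso (-n) n rfl).hom ≫ φ.f n ≫ F.map f)
        (show -(n : ℤ) + n = 0 by simp) (-m) (by lia)
        (by simpa [cochainComplex_d _ _ _ m n rfl rfl])) =
      φ.hom ≫ ShiftedHom.map (Cocycle.equivHomShift.symm
        (Cocycle.toSingleMk ((R.cochainComplexXIso (-n) n rfl).hom ≫ f)
          (show -(n : ℤ) + n = 0 by simp) (-m) (by lia)
          (by simpa [cochainComplex_d _ _ _ m n rfl rfl])))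
            (F.mapHomologicalComplex (ComplexShape.up ℤ)) ≫
        ((F.mapCochainComplexSingleFunctor 0).hom.app Y)⟦(n : ℤ)⟧' := by
  apply Cocycle.equivHomShift.injective
  rw [AddEquiv.apply_symm_apply]
  refine Subtype.ext (Cochain.ext _ _ fun p q hpq => ?_)
  obtain rfl | hp := eq_or_ne p (-n)
  · obtain rfl : q = 0 := by lia
    rw [equivHomShift_v]
    refine (Cochain.toSingleMk_v _ _).trans ?_
    have h1 := CochainComplex.map_f_comp_shiftFunctorObjXIso_hom F
      ((F.mapCochainComplexSingleFunctor 0).hom.app Y) (-n : ℤ) 0 hpq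
    have h2 := HomologicalComplex.singleMapHomologicalComplex_hom_app_self F (.up ℤ) 0 Y
    generalize hz : Cocycle.toSingleMk ((R.cochainComplexXIso (-n) n rfl).hom ≫ f)
          (show -(n : ℤ) + n = 0 by simp) (-m) (by lia) _ = z
    have h3 := equivHomShift_symm_f z (-n : ℤ) 0 hpq
    have h4 : z.1.v (-n : ℤ) 0 hpq = ((R.cochainComplexXIso (-n) n rfl).hom ≫ f) ≫
        (HomologicalComplex.singleObjXSelf (.up ℤ) 0 Y).inv := by
      rw [← hz]
      exact Cochain.toSingleMk_v _ _
    have h5 : F.map ((Cocycle.equivHomShift.symm z).f (-n : ℤ)) ≫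
        F.map (((singleFunctor C 0).obj Y).shiftFunctorObjXIso n (-n : ℤ) 0 hpq.symm).hom ≫
          F.map (HomologicalComplex.singleObjXSelf (.up ℤ) 0 Y).hom =
        F.map ((R.cochainComplexXIso (-n) n rfl).hom ≫ f) := by
      rw [← F.map_comp_assoc, h3, h4]
      refine (F.map_comp _ _).symm.trans (congrArg F.map ?_)
      exact ((Category.assoc _ _ _).trans ((congrArg (_ ≫ ·)
        (Iso.inv_hom_id (HomologicalComplex.singleObjXSelf (.up ℤ) 0 Y))).trans
          (Category.comp_id _)))
    have h6 : φ.homF (-n : ℤ) ≫ (F.map ((Cocycle.equivHomShift.symm z).f (-n : ℤ)) ≫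
        F.map (((singleFunctor C 0).obj Y).shiftFunctorObjXIso n (-n : ℤ) 0 hpq.symm).hom ≫
          F.map (HomologicalComplex.singleObjXSelf (.up ℤ) 0 Y).hom) =
        (R'.cochainComplexXIso (-n) n rfl).hom ≫ φ.f n ≫ F.map f := by
      rw [h5, φ.homF_eq _ n rfl]
      simp only [Category.assoc, ← F.map_comp, Iso.inv_hom_id_assoc]
    rw [← h6]
    -- The remaining diagram, stated for arbitrary morphisms: the objects in the goal agree with the
    -- expected ones only up to unfolding.
    have aux : ∀ {A₀ A₁ A₂ A₃ A₄ A₅ A₆ : D} {a₁ : A₀ ⟶ A₁} {a₂ : A₁ ⟶ A₂} {b : A₂ ⟶ A₃}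
        {c : A₃ ⟶ A₄} {s : A₂ ⟶ A₅} {σ : A₅ ⟶ A₄} {t : A₅ ⟶ A₆} {u : A₆ ⟶ A₄}
        (_ : b ≫ c = s ≫ σ) (_ : σ = t ≫ u),
        (a₁ ≫ a₂ ≫ s ≫ t) ≫ u = (a₁ ≫ (a₂ ≫ 𝟙 A₂) ≫ b) ≫ c := by
      intro _ _ _ _ _ _ _ _ _ _ _ _ _ _ _ e1 e2
      rw [e2] at e1
      simp [e1]
    exact aux h1 h2
  · exact (HomologicalComplex.isZero_single_obj_X _ _ _ _ (by lia)).eq_of_tgt _ _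

/-- The image under `Q` of `hom_comp_π'`, with the augmentations inverted: it replaces the image
under `F` of the inverse augmentation of `R` by the inverse augmentation of `R'` followed by the
comparison. -/
lemma map_Q_source [PreservesFiniteLimits F] [PreservesFiniteColimits F]
    [HasDerivedCategory.{w} C] [HasDerivedCategory.{w'} D] :
    (DerivedCategory.singleFunctor D 0).map g ≫
      (F.mapDerivedCategorySingleFunctor 0).inv.app X ≫
        F.mapDerivedCategory.map ((DerivedCategory.singleFunctorIsoCompQ C 0).hom.app X ≫
          inv (DerivedCategory.Q.map R.π')) ≫
            F.mapDerivedCategoryFactors.hom.app R.cochainComplex =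
    ((DerivedCategory.singleFunctorIsoCompQ D 0).hom.app X' ≫
      inv (DerivedCategory.Q.map R'.π')) ≫ DerivedCategory.Q.map φ.hom := by
  have hπ := congrArg DerivedCategory.Q.map φ.hom_comp_π'
  have e1 := F.mapDerivedCategorySingleFunctor_inv_app_mapDerivedCategoryFactors_hom_app X
  have e2 := F.mapDerivedCategoryFactors_hom_naturality R.π'
  have e3 : IsIso (F.mapDerivedCategory.map (DerivedCategory.Q.map R.π')) := inferInstance
  have e4 : IsIso (DerivedCategory.Q.map ((F.mapHomologicalComplex (.up ℤ)).map R.π')) :=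
    IsIso.of_isIso_fac_left e2.symm
  -- This is an isomorphism because exactness of `F` lets it act on the derived category, where the
  -- augmentation is already invertible (`e4`).
  rw [← cancel_mono (DerivedCategory.Q.map ((F.mapHomologicalComplex (.up ℤ)).map R.π'))]
  simp only [Category.assoc, ← e2, ← F.mapDerivedCategory.map_comp_assoc, IsIso.inv_hom_id,
    Category.comp_id]
  have h1 : F.mapDerivedCategory.map ((DerivedCategory.singleFunctorIsoCompQ C 0).hom.app X) =
    𝟙 _ := F.mapDerivedCategory.map_id _
  have h2 : (DerivedCategory.singleFunctorIsoCompQ D 0).hom.app X' = 𝟙 _ := rfl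
  have h3 : inv (DerivedCategory.Q.map R'.π') ≫ DerivedCategory.Q.map φ.hom ≫
      DerivedCategory.Q.map ((F.mapHomologicalComplex (.up ℤ)).map R.π') =
      DerivedCategory.Q.map ((singleFunctor D 0).map g) ≫
        DerivedCategory.Q.map ((F.mapCochainComplexSingleFunctor 0).inv.app X) := by
    rw [IsIso.inv_comp_eq, ← Functor.map_comp, ← Functor.map_comp, ← Functor.map_comp,
      ← reassoc_of% φ.hom_comp_π', Iso.hom_inv_id_app]
    exact congrArg _ (congrArg _ (Category.comp_id _).symm)
  rw [h1, h2, h3, ← e1]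
  refine Eq.trans ?_ (Category.id_comp _).symm
  exact congrArg (_ ≫ ·) (congrArg (_ ≫ ·) (Category.id_comp _))

lemma map_Q_target [PreservesFiniteLimits F] [PreservesFiniteColimits F]
    [HasDerivedCategory.{w} C] [HasDerivedCategory.{w'} D] (Y : C) :
    F.mapDerivedCategoryFactors.inv.app ((singleFunctor C 0).obj Y) ≫
      F.mapDerivedCategory.map ((DerivedCategory.singleFunctorIsoCompQ C 0).inv.app Y) ≫
        (F.mapDerivedCategorySingleFunctor 0).hom.app Y =
    DerivedCategory.Q.map ((F.mapCochainComplexSingleFunctor 0).hom.app Y) ≫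
      (DerivedCategory.singleFunctorIsoCompQ D 0).inv.app (F.obj Y) := by
  have e2 := F.mapDerivedCategoryFactors_inv_app_mapDerivedCategorySingleFunctor_hom_app Y
  rw [← e2]
  have h1 : F.mapDerivedCategory.map ((DerivedCategory.singleFunctorIsoCompQ C 0).inv.app Y) =
    𝟙 _ := F.mapDerivedCategory.map_id _
  have h2 : (DerivedCategory.singleFunctorIsoCompQ D 0).inv.app (F.obj Y) = 𝟙 _ := rfl
  rw [h1, h2]
  refine Eq.trans ?_ (Category.comp_id _).symm
  exact congrArg (_ ≫ ·) (Category.id_comp _)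

lemma map_Q_middle {K K' L L' : CochainComplex D ℤ} [HasDerivedCategory.{w'} D] {n : ℤ}
    (e : K' ⟶ K) (z : ShiftedHom K L n) (s : L ⟶ L') :
    ShiftedHom.map (Y := L') (e ≫ z ≫ s⟦n⟧') DerivedCategory.Q =
      DerivedCategory.Q.map e ≫ z.map DerivedCategory.Q ≫ (DerivedCategory.Q.map s)⟦n⟧' := by
  simp only [ShiftedHom.map, Functor.map_comp, Category.assoc,
    Functor.commShiftIso_hom_naturality]

lemma map_Q_shiftedHom [PreservesFiniteLimits F] [PreservesFiniteColimits F]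
    [HasDerivedCategory.{w} C] [HasDerivedCategory.{w'} D] {Y : C} {n : ℤ}
    (z : ShiftedHom R.cochainComplex ((singleFunctor C 0).obj Y) n) :
    (DerivedCategory.singleFunctor D 0).map g ≫
      (F.mapDerivedCategorySingleFunctor 0).inv.app X ≫
        (F.mapDerivedCategory.map ((DerivedCategory.singleFunctorIsoCompQ C 0).hom.app X ≫
          inv (DerivedCategory.Q.map R.π')) ≫
            (F.mapDerivedCategoryFactors.hom.app R.cochainComplex ≫
              (z.map (F.mapHomologicalComplex (ComplexShape.up ℤ))).map DerivedCategory.Q ≫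
                (F.mapDerivedCategoryFactors.inv.app ((singleFunctor C 0).obj Y))⟦n⟧') ≫
              (F.mapDerivedCategory.map
                ((DerivedCategory.singleFunctorIsoCompQ C 0).inv.app Y))⟦n⟧') ≫
          ((F.mapDerivedCategorySingleFunctor 0).hom.app Y)⟦n⟧' =
    ((DerivedCategory.singleFunctorIsoCompQ D 0).hom.app X' ≫
      inv (DerivedCategory.Q.map R'.π')) ≫
      ShiftedHom.map (φ.hom ≫ z.map (F.mapHomologicalComplex (ComplexShape.up ℤ)) ≫
          ((F.mapCochainComplexSingleFunctor 0).hom.app Y)⟦n⟧') DerivedCategory.Q ≫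
        ((DerivedCategory.singleFunctorIsoCompQ D 0).inv.app (F.obj Y))⟦n⟧' := by
  have h1 := φ.map_Q_source
  have h2 := congrArg (fun f => f⟦n⟧') (map_Q_target (F := F) Y)
  have h3 := map_Q_middle φ.hom (z.map (F.mapHomologicalComplex (ComplexShape.up ℤ)))
    ((F.mapCochainComplexSingleFunctor 0).hom.app Y)
  simp only [Functor.map_comp] at h2
  rw [h3]
  simp only [Category.assoc]
  rw [h2]
  simp only [← Category.assoc]
  simp only [← Category.assoc] at h1
  rw [h1]

end MapHom

end CategoryTheory.ProjectiveResolution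

namespace CategoryTheory.Abelian.Ext

open ProjectiveResolution

variable {C : Type u} [Category.{v} C] [Abelian C] {D : Type u'} [Category.{v'} D] [Abelian D]
  {F : C ⥤ D} [F.Additive] {X : C} {X' : D}
  [PreservesFiniteLimits F] [PreservesFiniteColimits F]

/-- In the derived category a class is the inverse augmentation followed by its cocycle. Applying
`F` and replacing the image of `R` by `R'` through the comparison composes the image of the cocycle
with `φ`. Thus twists of classes become computable on cocycles. -/
theorem mk₀_comp_mapExactFunctor_extMk [HasExt.{w} C] [HasExt.{w'} D] {Y : C}
    {R : ProjectiveResolution X} {R' : ProjectiveResolution X'} {g : X' ⟶ F.obj X}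
    (φ : MapHom R' R F g)
    {n : ℕ} (f : R.complex.X n ⟶ Y) (m : ℕ) (hm : n + 1 = m) (hf : R.complex.d m n ≫ f = 0)
    (hf' : R'.complex.d m n ≫ φ.f n ≫ F.map f = 0) :
    (Ext.mk₀ g).comp ((R.extMk f m hm hf).mapExactFunctor F) (zero_add n) =
      R'.extMk (φ.f n ≫ F.map f) m hm hf' := by
  have := HasDerivedCategory.standard C
  have := HasDerivedCategory.standard D
  ext
  rw [comp_hom, mapExactFunctor_hom, extMk_hom, extMk_hom, mk₀_hom]
  rw [ShiftedHom.mk₀_comp, ShiftedHom.map_comp, ShiftedHom.map_comp, ShiftedHom.map_mk₀,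
    ShiftedHom.map_mk₀, ← ShiftedHom.comp_map]
  rw [← ShiftedHom.map_naturality_2 _ F.mapDerivedCategoryFactors]
  rw [ShiftedHom.comp_map]
  have hz := φ.equivHomShift_toSingleMk f m hm hf hf'
  rw [hz]
  simp only [ShiftedHom.comp_mk₀, ShiftedHom.mk₀_comp]
  exact φ.map_Q_shiftedHom _

end CategoryTheory.Abelian.Ext
end MapExt

/-! ### Naturality of exact functors on `Ext`, and anticommuting connecting classes -/

section ExtTransformations

universe w w' w'' u' v' u'' v''

open Limits

namespace CategoryTheory.Abelian.Ext

section

variable {C : Type u} [Category.{v} C] [Abelian C] [HasExt.{w} C]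

/-- Dimension shifting: a class of positive degree factors through the connecting class of a short
exact sequence with projective middle term. -/
lemma exists_extClass_comp {S : ShortComplex C} (hS : S.ShortExact) [Projective S.X₂] {Y : C}
    {n : ℕ} (α : Ext S.X₃ Y (n + 1)) :
    ∃ β : Ext S.X₁ Y n, hS.extClass.comp β (add_comm 1 n) = α :=
  contravariant_sequence_exact₃ hS Y α (eq_zero_of_projective _) (add_comm 1 n)

/-- Induction on the classes in `Ext`. -/
theorem induction [EnoughProjectives C]
    {motive : ∀ {X Y : C} {n : ℕ}, Ext X Y n → Prop}
    (mk₀ : ∀ {X Y : C} (f : X ⟶ Y), motive (Ext.mk₀ f))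
    (extClass_comp : ∀ {S : ShortComplex C} (hS : S.ShortExact) {Y : C} {n : ℕ}
      (β : Ext S.X₁ Y n), motive β → motive (hS.extClass.comp β (add_comm 1 n)))
    {X Y : C} {n : ℕ} (α : Ext X Y n) : motive α := by
  induction n generalizing X with
  | zero =>
    obtain ⟨f, rfl⟩ := (mk₀_bijective X Y).2 α
    exact mk₀ f
  | succ n ih =>
    let S : ShortComplex C := ShortComplex.mk (kernel.ι (Projective.π X)) (Projective.π X) (by simp)
    have hS : S.ShortExact := { exact := ShortComplex.exact_kernel _ }
    have : Projective S.X₂ := inferInstanceAs (Projective (Projective.over X))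
    obtain ⟨β, rfl⟩ := exists_extClass_comp hS α
    exact extClass_comp hS β (ih β)

end

section

variable {C : Type u} [Category.{v} C] [Abelian C] [HasExt.{w} C] [EnoughProjectives C]

-- Each summand is the connecting class of `S`, then `aᵢ ≫ bᵢ`, then `S.f`, then `κ`. The middle
-- morphisms add up to the identity, and the connecting class composed with `S.f` is zero.
omit [EnoughProjectives C] in
lemma extClass_comp_add_eq_zero {S : ShortComplex C} (hS : S.ShortExact) {X₁ X₂ Y : C}
    {a₁ : S.X₁ ⟶ X₁} {a₂ : S.X₁ ⟶ X₂} {b₁ : X₁ ⟶ S.X₁} {b₂ : X₂ ⟶ S.X₁} {κ : Ext S.X₂ Y 1}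
    {ε₁ : Ext S.X₃ X₁ 1} {ε₂ : Ext S.X₃ X₂ 1} {δ₁ : Ext X₁ Y 1} {δ₂ : Ext X₂ Y 1}
    (hε₁ : ε₁ = hS.extClass.comp (mk₀ a₁) (add_zero 1))
    (hε₂ : ε₂ = hS.extClass.comp (mk₀ a₂) (add_zero 1))
    (hδ₁ : δ₁ = (mk₀ (b₁ ≫ S.f)).comp κ (zero_add 1))
    (hδ₂ : δ₂ = (mk₀ (b₂ ≫ S.f)).comp κ (zero_add 1))
    (h : a₁ ≫ b₁ + a₂ ≫ b₂ = 𝟙 S.X₁) :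
    ε₁.comp δ₁ rfl + ε₂.comp δ₂ rfl = 0 := by
  have key : ∀ {Z : C} (a : S.X₁ ⟶ Z) (b : Z ⟶ S.X₁),
      (hS.extClass.comp (mk₀ a) (add_zero 1)).comp
        ((mk₀ (b ≫ S.f)).comp κ (zero_add 1)) rfl =
      hS.extClass.comp ((mk₀ (a ≫ b)).comp ((mk₀ S.f).comp κ (zero_add 1))
        (zero_add 1)) rfl := by
    intro Z a b
    rw [comp_assoc_of_second_deg_zero, ← mk₀_comp_mk₀ b, ← mk₀_comp_mk₀ a,
      comp_assoc_of_second_deg_zero, comp_assoc_of_second_deg_zero]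
  rw [hε₁, hε₂, hδ₁, hδ₂, key, key, ← comp_add, ← add_comp, ← mk₀_add, h, mk₀_id_comp]
  exact hS.extClass_comp_assoc _

lemma mapExactFunctor_id {X Y : C} {n : ℕ} (α : Ext X Y n) : α.mapExactFunctor (𝟭 C) = α := by
  induction α using induction with
  | mk₀ f => exact mapExactFunctor_mk₀ _ f
  | extClass_comp hS β hβ =>
    rw [mapExactFunctor_comp, mapExactFunctor_extClass]
    exact congrArg (fun γ => hS.extClass.comp γ (add_comm 1 _)) hβ

variable {D : Type u'} [Category.{v'} D] [Abelian D] [HasExt.{w'} D]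
  {F G : C ⥤ D} [F.Additive] [PreservesFiniteLimits F] [PreservesFiniteColimits F]
  [G.Additive] [PreservesFiniteLimits G] [PreservesFiniteColimits G]

omit [EnoughProjectives C] in
lemma mapExactFunctor_extClass_naturality (τ : F ⟶ G) {S : ShortComplex C} (hS : S.ShortExact) :
    (hS.extClass.mapExactFunctor F).comp (mk₀ (τ.app S.X₁)) (add_zero 1) =
      (mk₀ (τ.app S.X₃)).comp (hS.extClass.mapExactFunctor G) (zero_add 1) := by
  rw [mapExactFunctor_extClass, mapExactFunctor_extClass]
  exact ShortComplex.ShortExact.extClass_naturality (hS.map_of_exact F) (hS.map_of_exact G)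
    (S.mapNatTrans τ)

/-- The action of exact functors on `Ext` is natural in the functor. -/
theorem mapExactFunctor_naturality (τ : F ⟶ G) {X Y : C} {n : ℕ} (α : Ext X Y n) :
    (α.mapExactFunctor F).comp (mk₀ (τ.app Y)) (add_zero n) =
      (mk₀ (τ.app X)).comp (α.mapExactFunctor G) (zero_add n) := by
  induction α using induction with
  | mk₀ f =>
    rw [mapExactFunctor_mk₀, mapExactFunctor_mk₀, mk₀_comp_mk₀, mk₀_comp_mk₀, τ.naturality]
  | @extClass_comp S hS Y n β hβ =>
    rw [mapExactFunctor_comp, mapExactFunctor_comp, comp_assoc_of_third_deg_zero, hβ,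
      ← comp_assoc_of_second_deg_zero, mapExactFunctor_extClass_naturality,
      comp_assoc (mk₀ _) _ _ (zero_add 1) (add_comm 1 n) (by lia)]

end

section

variable {R : Type u} [Ring R] [HasExt.{w} (ModuleCat.{v} R)]

/-- In a diagram of modules with short exact rows and columns, the two composites of connecting
classes from the lower right to the upper left corner are opposite to each other. -/
theorem extClass_comp_extClass_add {A B E : ShortComplex (ModuleCat.{v} R)}
    (hA : A.ShortExact) (hB : B.ShortExact) (hE : E.ShortExact) (i : A ⟶ B) (p : B ⟶ E)
    (w₁ : i.τ₁ ≫ p.τ₁ = 0) (w₂ : i.τ₂ ≫ p.τ₂ = 0) (w₃ : i.τ₃ ≫ p.τ₃ = 0)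
    (h₁ : (ShortComplex.mk _ _ w₁).ShortExact) (h₂ : (ShortComplex.mk _ _ w₂).ShortExact)
    (h₃ : (ShortComplex.mk _ _ w₃).ShortExact) :
    hE.extClass.comp h₁.extClass rfl + h₃.extClass.comp hA.extClass rfl = 0 := by
  have sq₁ (x : B.X₁) : p.τ₂ (B.f x) = E.f (p.τ₁ x) := (ConcreteCategory.congr_hom p.comm₁₂ x).symm
  have sq₂ (x : B.X₂) : p.τ₃ (B.g x) = E.g (p.τ₂ x) := (ConcreteCategory.congr_hom p.comm₂₃ x).symm
  have sq₃ (x : A.X₁) : i.τ₂ (A.f x) = B.f (i.τ₁ x) := (ConcreteCategory.congr_hom i.comm₁₂ x).symm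
  have sq₄ (x : A.X₂) : i.τ₃ (A.g x) = B.g (i.τ₂ x) := (ConcreteCategory.congr_hom i.comm₂₃ x).symm
  have z₂ (x : A.X₂) : p.τ₂ (i.τ₂ x) = 0 := ConcreteCategory.congr_hom w₂ x
  have z₃ (x : A.X₃) : p.τ₃ (i.τ₃ x) = 0 := ConcreteCategory.congr_hom w₃ x
  have zE (x : E.X₁) : E.g (E.f x) = 0 := E.zero_apply x
  have zB (x : B.X₁) : B.g (B.f x) = 0 := B.zero_apply x
  have ex₂ : ∀ x : B.X₂, p.τ₂ x = 0 → ∃ a, i.τ₂ a = x := (ShortComplex.moduleCat_exact_iff _).1 h₂.exact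
  have ex₃ : ∀ x : B.X₃, p.τ₃ x = 0 → ∃ a, i.τ₃ a = x := (ShortComplex.moduleCat_exact_iff _).1 h₃.exact
  have exE : ∀ x : E.X₂, E.g x = 0 → ∃ a, E.f a = x := (ShortComplex.moduleCat_exact_iff _).1 hE.exact
  have exA : ∀ x : A.X₂, A.g x = 0 → ∃ a, A.f a = x := (ShortComplex.moduleCat_exact_iff _).1 hA.exact
  have in₁ : Function.Injective i.τ₁ := h₁.moduleCat_injective_f
  have in₃ : Function.Injective i.τ₃ := h₃.moduleCat_injective_f
  have inE : Function.Injective E.f := hE.moduleCat_injective_f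
  have inB : Function.Injective B.f := hB.moduleCat_injective_f
  have su₂ : Function.Surjective p.τ₂ := h₂.moduleCat_surjective_g
  have su₃ : Function.Surjective p.τ₃ := h₃.moduleCat_surjective_g
  have suE : Function.Surjective E.g := hE.moduleCat_surjective_g
  have suA : Function.Surjective A.g := hA.moduleCat_surjective_g
  have suB : Function.Surjective B.g := hB.moduleCat_surjective_g
  -- `N` is the pullback of `E.X₂` and `B.X₃` over `E.X₃`. It maps onto `E.X₃` with kernel `E.X₁ ×
  -- A.X₃` (the sequence `S`), and `B.X₂` maps onto it with kernel `A.X₁` (the sequence `T`). The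
  -- outer sequences of the 3×3 diagram are recovered by pushing out `S` along the two projections
  -- and pulling back `T` along the two inclusions.
  let N : Submodule R (E.X₂ × B.X₃) :=
    LinearMap.eqLocus (E.g.hom ∘ₗ LinearMap.fst R E.X₂ B.X₃) (p.τ₃.hom ∘ₗ LinearMap.snd R E.X₂ B.X₃)
  let j : E.X₁ × A.X₃ →ₗ[R] N := (E.f.hom.prodMap i.τ₃.hom).codRestrict N fun x =>
    (zE x.1).trans (z₃ x.2).symm
  let u : B.X₂ →ₗ[R] N := (p.τ₂.hom.prod B.g.hom).codRestrict N fun x => (sq₂ x).symm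
  let S : ShortComplex (ModuleCat.{v} R) :=
    { X₁ := ModuleCat.of R (E.X₁ × A.X₃)
      X₂ := ModuleCat.of R N
      X₃ := E.X₃
      f := ModuleCat.ofHom j
      g := ModuleCat.ofHom (E.g.hom ∘ₗ LinearMap.fst R E.X₂ B.X₃ ∘ₗ N.subtype)
      zero := ModuleCat.hom_ext (LinearMap.ext fun x : E.X₁ × A.X₃ => zE x.1) }
  have hS : S.ShortExact :=
    { exact := (ShortComplex.moduleCat_exact_iff _).2 (by
        rintro ⟨⟨x, y⟩, hxy⟩ hx
        obtain ⟨a, rfl⟩ := exE x hx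
        obtain ⟨b, rfl⟩ := ex₃ y (hxy.symm.trans hx)
        exact ⟨(a, b), rfl⟩)
      mono_f := (ModuleCat.mono_iff_injective _).2 fun x y hxy =>
        Prod.ext (inE (congrArg (fun z : N => z.1.1) hxy)) (in₃ (congrArg (fun z : N => z.1.2) hxy))
      epi_g := (ModuleCat.epi_iff_surjective _).2 fun x => by
        obtain ⟨y, rfl⟩ := suE x
        obtain ⟨b, hb⟩ := su₃ (E.g y)
        exact ⟨⟨(y, b), hb.symm⟩, rfl⟩ }
  let T : ShortComplex (ModuleCat.{v} R) :=
    { X₁ := A.X₁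
      X₂ := B.X₂
      X₃ := ModuleCat.of R N
      f := i.τ₁ ≫ B.f
      g := ModuleCat.ofHom u
      zero := ModuleCat.hom_ext (LinearMap.ext fun x : A.X₁ => Subtype.ext
        (Prod.ext ((congrArg p.τ₂ (sq₃ x).symm).trans (z₂ _)) (zB (i.τ₁ x)))) }
  have hT : T.ShortExact :=
    { exact := (ShortComplex.moduleCat_exact_iff _).2 (by
        intro x hx
        obtain ⟨y, rfl⟩ := ex₂ x (congrArg (fun z : N => z.1.1) hx)
        have hy : A.g y = 0 := in₃ (((sq₄ y).trans (congrArg (fun z : N => z.1.2) hx)).trans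
          (map_zero i.τ₃.hom).symm)
        obtain ⟨a, rfl⟩ := exA y hy
        exact ⟨a, (sq₃ a).symm⟩)
      mono_f := (ModuleCat.mono_iff_injective _).2 fun x y hxy => in₁ (inB hxy)
      epi_g := (ModuleCat.epi_iff_surjective _).2 (by
        rintro ⟨⟨x, y⟩, hxy⟩
        obtain ⟨b, rfl⟩ := su₂ x
        -- A lift `b` of the first coordinate misses the second one by an element of `A.X₃`; lifting
        -- that element to `A.X₂` corrects `b` without changing its image in `E.X₂`.
        have hb : p.τ₃ (y - B.g b) = 0 := by
          rw [map_sub, sub_eq_zero, sq₂]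
          exact hxy.symm
        obtain ⟨a, ha⟩ := ex₃ _ hb
        obtain ⟨c, rfl⟩ := suA a
        refine ⟨b + i.τ₂ c, Subtype.ext (Prod.ext ?_ ?_)⟩
        · exact (map_add p.τ₂.hom _ _).trans ((congrArg (_ + ·) (z₂ c)).trans (add_zero _))
        · refine (map_add B.g.hom _ _).trans ((congrArg (_ + ·) ((sq₄ c).symm.trans ha)).trans ?_)
          exact add_sub_cancel _ _) }
  let S₃ : ShortComplex (ModuleCat.{v} R) := ShortComplex.mk _ _ w₃
  let S₁ : ShortComplex (ModuleCat.{v} R) := ShortComplex.mk _ _ w₁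
  let f₁ : S ⟶ E :=
    { τ₁ := ModuleCat.ofHom (LinearMap.fst R E.X₁ A.X₃)
      τ₂ := ModuleCat.ofHom (LinearMap.fst R E.X₂ B.X₃ ∘ₗ N.subtype)
      τ₃ := 𝟙 _ }
  let f₃ : S ⟶ S₃ :=
    { τ₁ := ModuleCat.ofHom (LinearMap.snd R E.X₁ A.X₃)
      τ₂ := ModuleCat.ofHom (LinearMap.snd R E.X₂ B.X₃ ∘ₗ N.subtype)
      τ₃ := 𝟙 _
      comm₂₃ := ModuleCat.hom_ext (LinearMap.ext fun x : N => x.2.symm) }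
  let l₁ : E.X₁ ⟶ S.X₁ := ModuleCat.ofHom (LinearMap.inl R E.X₁ A.X₃)
  let l₃ : A.X₃ ⟶ S.X₁ := ModuleCat.ofHom (LinearMap.inr R E.X₁ A.X₃)
  let g₁ : S₁ ⟶ T :=
    { τ₁ := 𝟙 _
      τ₂ := B.f
      τ₃ := l₁ ≫ S.f
      comm₂₃ := ModuleCat.hom_ext (LinearMap.ext fun x : B.X₁ => Subtype.ext
        (Prod.ext (sq₁ x) ((zB x).trans (map_zero i.τ₃.hom).symm))) }
  let g₃ : A ⟶ T :=
    { τ₁ := 𝟙 _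
      τ₂ := i.τ₂
      τ₃ := l₃ ≫ S.f
      comm₁₂ := i.comm₁₂
      comm₂₃ := ModuleCat.hom_ext (LinearMap.ext fun x : A.X₂ => Subtype.ext
        (Prod.ext ((z₂ x).trans (map_zero E.f.hom).symm) (sq₄ x).symm)) }
  have e₁ : hE.extClass = hS.extClass.comp (mk₀ f₁.τ₁) (add_zero 1) :=
    ((ShortComplex.ShortExact.extClass_naturality hS hE f₁).trans (mk₀_id_comp _)).symm
  have e₃ : h₃.extClass = hS.extClass.comp (mk₀ f₃.τ₁) (add_zero 1) :=
    ((ShortComplex.ShortExact.extClass_naturality hS h₃ f₃).trans (mk₀_id_comp _)).symm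
  have d₁ : h₁.extClass = (mk₀ (l₁ ≫ S.f)).comp hT.extClass (zero_add 1) :=
    (comp_mk₀_id _).symm.trans (ShortComplex.ShortExact.extClass_naturality h₁ hT g₁)
  have d₃ : hA.extClass = (mk₀ (l₃ ≫ S.f)).comp hT.extClass (zero_add 1) :=
    (comp_mk₀_id _).symm.trans (ShortComplex.ShortExact.extClass_naturality hA hT g₃)
  -- The last hypothesis is the decomposition of the identity of `E.X₁ × A.X₃` into its two
  -- components.
  exact extClass_comp_add_eq_zero hS e₁ e₃ d₁ d₃ (ModuleCat.hom_ext (LinearMap.ext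
    fun x : E.X₁ × A.X₃ => Prod.ext (add_zero x.1) (zero_add x.2)))

end

end CategoryTheory.Abelian.Ext

end ExtTransformations

/-! ### Short exact sequences of exact functors -/

section FunctorSequences

universe w w' w'' u' v' u'' v''

open Limits Abelian.Ext

namespace CategoryTheory

lemma Abelian.Ext.comp_zsmul {C : Type u} [Category.{v} C] [Abelian C] [HasExt.{w} C] {X Y Z : C}
    {a b c : ℕ} (α : Ext X Y a) (n : ℤ) (β : Ext Y Z b) (h : a + b = c) :
    α.comp (n • β) h = n • α.comp β h :=
  map_zsmul ({ toFun := fun β => α.comp β h, map_zero' := comp_zero _ _ _ _ _,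
               map_add' := fun _ _ => comp_add _ _ _ _ } : Ext Y Z b →+ Ext X Z c) n β

lemma Abelian.Ext.zsmul_comp {C : Type u} [Category.{v} C] [Abelian C] [HasExt.{w} C] {X Y Z : C}
    {a b c : ℕ} (n : ℤ) (α : Ext X Y a) (β : Ext Y Z b) (h : a + b = c) :
    (n • α).comp β h = n • α.comp β h :=
  map_zsmul ({ toFun := fun α => α.comp β h, map_zero' := zero_comp _ _ _ _ _,
               map_add' := fun _ _ => add_comp _ _ _ _ } : Ext X Y a →+ Ext X Z c) n α

lemma Abelian.Ext.mapExactFunctor_mapExactFunctor {C : Type u} [Category.{v} C] [Abelian C]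
    [HasExt.{w} C] [EnoughProjectives C] {D : Type u'} [Category.{v'} D] [Abelian D] [HasExt.{w'} D]
    {E : Type u''} [Category.{v''} E] [Abelian E] [HasExt.{w''} E] (F : C ⥤ D) (G : D ⥤ E)
    [F.Additive] [PreservesFiniteLimits F] [PreservesFiniteColimits F]
    [G.Additive] [PreservesFiniteLimits G] [PreservesFiniteColimits G]
    {X Y : C} {n : ℕ} (α : Ext X Y n) :
    (α.mapExactFunctor F).mapExactFunctor G = α.mapExactFunctor (F ⋙ G) := by
  induction α using Ext.induction with
  | mk₀ f =>
    rw [mapExactFunctor_mk₀, mapExactFunctor_mk₀, mapExactFunctor_mk₀]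
    rfl
  | extClass_comp hS β hβ =>
    rw [mapExactFunctor_comp, mapExactFunctor_comp, mapExactFunctor_comp, hβ]
    congr 1
    exact (congrArg (mapExactFunctor G) (mapExactFunctor_extClass F hS)).trans
      ((mapExactFunctor_extClass G (hS.map_of_exact F)).trans
        (mapExactFunctor_extClass (F ⋙ G) hS).symm)

lemma ShortComplex.exact_of_evaluation {C : Type u} [Category.{v} C] {D : Type u'}
    [Category.{v'} D] [Abelian D] (S : ShortComplex (C ⥤ D))
    (h : ∀ X, (S.map ((evaluation C D).obj X)).Exact) : S.Exact := by
  rw [ShortComplex.exact_iff_isZero_homology, Functor.isZero_iff]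
  intro X
  exact ((ShortComplex.exact_iff_isZero_homology _).1 (h X)).of_iso
    (S.mapHomologyIso ((evaluation C D).obj X)).symm

variable {C : Type u} [Category.{v} C] [Abelian C]

section

variable {R : Type u'} [Ring R]

/-- The nine lemma for the diagram of the values of `S` on `T`: two of the three functors give short
exact sequences, hence so does the kernel. -/
lemma shortExact_map_of_shortExact {S : ShortComplex (C ⥤ ModuleCat.{v'} R)} (hS : S.ShortExact)
    [S.X₁.Additive] [S.X₂.Additive] [S.X₃.Additive]
    [PreservesFiniteLimits S.X₂] [PreservesFiniteColimits S.X₂]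
    [PreservesFiniteLimits S.X₃] [PreservesFiniteColimits S.X₃] {T : ShortComplex C}
    (hT : T.ShortExact) : (T.map S.X₁).ShortExact := by
  have h₁ := hS.map_of_exact ((evaluation _ _).obj T.X₁)
  have h₂ := hS.map_of_exact ((evaluation _ _).obj T.X₂)
  have h₃ := hS.map_of_exact ((evaluation _ _).obj T.X₃)
  have hB := hT.map_of_exact S.X₂
  have hE := hT.map_of_exact S.X₃
  have in₁ : Function.Injective (S.f.app T.X₁) := h₁.moduleCat_injective_f
  have in₂ : Function.Injective (S.f.app T.X₂) := h₂.moduleCat_injective_f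
  have in₃ : Function.Injective (S.f.app T.X₃) := h₃.moduleCat_injective_f
  have inB : Function.Injective (S.X₂.map T.f) := hB.moduleCat_injective_f
  have inE : Function.Injective (S.X₃.map T.f) := hE.moduleCat_injective_f
  have su₁ : Function.Surjective (S.g.app T.X₁) := h₁.moduleCat_surjective_g
  have suB : Function.Surjective (S.X₂.map T.g) := hB.moduleCat_surjective_g
  have ex₁ : ∀ x, S.g.app T.X₁ x = 0 → ∃ a, S.f.app T.X₁ a = x :=
    (ShortComplex.moduleCat_exact_iff _).1 h₁.exact
  have ex₂ : ∀ x, S.g.app T.X₂ x = 0 → ∃ a, S.f.app T.X₂ a = x :=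
    (ShortComplex.moduleCat_exact_iff _).1 h₂.exact
  have exB : ∀ x, S.X₂.map T.g x = 0 → ∃ a, S.X₂.map T.f a = x :=
    (ShortComplex.moduleCat_exact_iff _).1 hB.exact
  have exE : ∀ x, S.X₃.map T.g x = 0 → ∃ a, S.X₃.map T.f a = x :=
    (ShortComplex.moduleCat_exact_iff _).1 hE.exact
  have z₂ : ∀ x, S.g.app T.X₂ (S.f.app T.X₂ x) = 0 := fun x =>
    ConcreteCategory.congr_hom (NatTrans.congr_app S.zero T.X₂) x
  have z₃ : ∀ x, S.g.app T.X₃ (S.f.app T.X₃ x) = 0 := fun x =>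
    ConcreteCategory.congr_hom (NatTrans.congr_app S.zero T.X₃) x
  have nf : ∀ {X Y : C} (a : X ⟶ Y) (x : S.X₁.obj X),
      S.f.app Y (S.X₁.map a x) = S.X₂.map a (S.f.app X x) := fun a x =>
    ConcreteCategory.congr_hom (S.f.naturality a) x
  have ng : ∀ {X Y : C} (a : X ⟶ Y) (x : S.X₂.obj X),
      S.g.app Y (S.X₂.map a x) = S.X₃.map a (S.g.app X x) := fun a x =>
    ConcreteCategory.congr_hom (S.g.naturality a) x
  have exact : ∀ x : S.X₁.obj T.X₂, S.X₁.map T.g x = 0 → ∃ a, S.X₁.map T.f a = x := fun x hx => by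
    obtain ⟨b, hb⟩ := exB (S.f.app T.X₂ x) (by rw [← nf, hx, map_zero])
    have hb' : S.g.app T.X₁ b = 0 := inE (by rw [← ng, hb, z₂, map_zero])
    obtain ⟨a, rfl⟩ := ex₁ b hb'
    exact ⟨a, in₂ ((nf T.f a).trans hb)⟩
  have inj : Function.Injective (S.X₁.map T.f) := fun x y hxy =>
    in₁ (inB (by rw [← nf, hxy, nf]))
  have surj : Function.Surjective (S.X₁.map T.g) := fun x => by
    obtain ⟨b, hb⟩ := suB (S.f.app T.X₃ x)
    obtain ⟨e, he⟩ := exE (S.g.app T.X₂ b) (by rw [← ng, hb, z₃])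
    obtain ⟨c, rfl⟩ := su₁ e
    -- Subtracting the image of `c` moves `b` into the kernel of `S.g` and does not change its image
    -- over `T.X₃`, because `T.f ≫ T.g = 0`.
    obtain ⟨a, ha⟩ := ex₂ (b - S.X₂.map T.f c) (by rw [map_sub, ng, he, sub_self])
    refine ⟨a, in₃ ?_⟩
    have hz : S.X₂.map T.g (S.X₂.map T.f c) = 0 :=
      ConcreteCategory.congr_hom ((S.X₂.map_comp T.f T.g).symm.trans
        ((congrArg S.X₂.map T.zero).trans (S.X₂.map_zero _ _))) c
    exact (nf T.g a).trans (by rw [ha, map_sub, hz, sub_zero, hb])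
  exact { exact := (ShortComplex.moduleCat_exact_iff _).2 exact
          mono_f := (ModuleCat.mono_iff_injective _).2 inj
          epi_g := (ModuleCat.epi_iff_surjective _).2 surj }

/-- The kernel of an epimorphism between exact functors is an exact functor. -/
lemma preservesFiniteLimits_and_colimits_of_shortExact {S : ShortComplex (C ⥤ ModuleCat.{v'} R)}
    (hS : S.ShortExact) [S.X₁.Additive] [S.X₂.Additive] [S.X₃.Additive]
    [PreservesFiniteLimits S.X₂] [PreservesFiniteColimits S.X₂]
    [PreservesFiniteLimits S.X₃] [PreservesFiniteColimits S.X₃] :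
    PreservesFiniteLimits S.X₁ ∧ PreservesFiniteColimits S.X₁ :=
  (S.X₁.exact_tfae.out 0 3).1 fun _ hT => shortExact_map_of_shortExact hS hT

variable [HasExt.{w} C] [HasExt.{w'} (ModuleCat.{v'} R)]

/-- The connecting class at `X` of a short exact sequence of functors. -/
def ShortComplex.ShortExact.extClassAt {S : ShortComplex (C ⥤ ModuleCat.{v'} R)} (hS : S.ShortExact)
    (X : C) : Ext.{w'} (S.X₃.obj X) (S.X₁.obj X) 1 :=
  (hS.map_of_exact ((evaluation _ _).obj X)).extClass

/-- The connecting class of a short exact sequence of exact functors commutes with the action of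
these functors on `Ext` up to the usual sign. -/
theorem mapExactFunctor_comp_extClassAt [EnoughProjectives C]
    {S : ShortComplex (C ⥤ ModuleCat.{v'} R)} (hS : S.ShortExact)
    [S.X₁.Additive] [S.X₂.Additive] [S.X₃.Additive]
    [PreservesFiniteLimits S.X₁] [PreservesFiniteColimits S.X₁]
    [PreservesFiniteLimits S.X₂] [PreservesFiniteColimits S.X₂]
    [PreservesFiniteLimits S.X₃] [PreservesFiniteColimits S.X₃]
    {X Y : C} {n : ℕ} (α : Ext X Y n) :
    (α.mapExactFunctor S.X₃).comp (hS.extClassAt Y) rfl =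
      (-1 : ℤ) ^ n • (hS.extClassAt X).comp (α.mapExactFunctor S.X₁) (add_comm 1 n) := by
  induction α using Ext.induction with
  | @mk₀ X Y f =>
    rw [mapExactFunctor_mk₀, mapExactFunctor_mk₀, pow_zero, one_smul]
    let φ : S.map ((evaluation _ _).obj X) ⟶ S.map ((evaluation _ _).obj Y) :=
      S.mapNatTrans ((evaluation _ _).map f)
    exact (ShortComplex.ShortExact.extClass_naturality _ _ φ).symm
  | @extClass_comp T hT Y n β hβ =>
    -- All signs originate here: the values of `S` on `T` form a 3×3 diagram, so interchanging the
    -- two connecting classes costs one factor `-1`.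
    have h : (hT.extClass.mapExactFunctor S.X₃).comp (hS.extClassAt T.X₁) (rfl : 1 + 1 = 2) =
        -(hS.extClassAt T.X₃).comp (hT.extClass.mapExactFunctor S.X₁) (rfl : 1 + 1 = 2) := by
      rw [eq_neg_iff_add_eq_zero, mapExactFunctor_extClass, mapExactFunctor_extClass]
      exact extClass_comp_extClass_add (hT.map_of_exact S.X₁) (hT.map_of_exact S.X₂)
        (hT.map_of_exact S.X₃) (T.mapNatTrans S.f) (T.mapNatTrans S.g) _ _ _
        (hS.map_of_exact ((evaluation _ _).obj T.X₁))
        (hS.map_of_exact ((evaluation _ _).obj T.X₂))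
        (hS.map_of_exact ((evaluation _ _).obj T.X₃))
    rw [mapExactFunctor_comp, mapExactFunctor_comp,
      comp_assoc _ _ _ _ rfl (by lia), hβ, comp_zsmul,
      ← comp_assoc _ _ _ rfl _ (by lia), h, neg_comp, comp_assoc _ _ _ _ (add_comm 1 n) (by lia),
      pow_succ, mul_neg_one, neg_smul, smul_neg]

end

end CategoryTheory

end FunctorSequences

/-! ### Splices of a sequence `0 ⟶ Ω ⟶ B ⟶ 𝟭 ⟶ 0` of functors -/

section Syzygies

universe w u'

open Limits Abelian.Ext

namespace CategoryTheory

section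

variable {C : Type u} [Category.{v} C]

/-- The iterates of an endofunctor. -/
def Functor.iter (Ω : C ⥤ C) : ℕ → (C ⥤ C)
  | 0 => 𝟭 C
  | n + 1 => Ω.iter n ⋙ Ω

instance [Preadditive C] (Ω : C ⥤ C) [Ω.Additive] (n : ℕ) : (Ω.iter n).Additive := by
  induction n with
  | zero => exact inferInstanceAs (𝟭 C).Additive
  | succ n _ => exact inferInstanceAs (Ω.iter n ⋙ Ω).Additive

instance (Ω : C ⥤ C) [PreservesFiniteLimits Ω] (n : ℕ) : PreservesFiniteLimits (Ω.iter n) := by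
  induction n with
  | zero => exact inferInstanceAs (PreservesFiniteLimits (𝟭 C))
  | succ n _ => exact comp_preservesFiniteLimits (Ω.iter n) Ω

instance (Ω : C ⥤ C) [PreservesFiniteColimits Ω] (n : ℕ) : PreservesFiniteColimits (Ω.iter n) := by
  induction n with
  | zero => exact inferInstanceAs (PreservesFiniteColimits (𝟭 C))
  | succ n _ => exact comp_preservesFiniteColimits (Ω.iter n) Ω

end

/-- The inductive step of `comp_syzygyClass`, for unrelated objects so that the iterates of `Ω` do
not obstruct rewriting. -/
lemma Abelian.Ext.comp_comp_eq_smul {C : Type u} [Category.{v} C] [Abelian C] [HasExt.{w} C]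
    {X Y X₁ Y₁ X₂ Y₂ : C} {q n m : ℕ} {α : Ext X Y q} {vX : Ext X X₁ n} {vY : Ext Y Y₁ n}
    {sX : Ext X₁ X₂ 1} {sY : Ext Y₁ Y₂ 1} {α₁ : Ext X₁ Y₁ q} {α₂ : Ext X₂ Y₂ q}
    (h₁ : α.comp vY rfl = (-1 : ℤ) ^ (q * n) • vX.comp α₁ (add_comm n q))
    (h₂ : α₁.comp sY rfl = (-1 : ℤ) ^ q • sX.comp α₂ (add_comm 1 q))
    (h : q + (n + 1) = m) (h' : n + 1 + q = m) :
    α.comp (vY.comp sY rfl) h = (-1 : ℤ) ^ (q * (n + 1)) • (vX.comp sX rfl).comp α₂ h' := by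
  rw [← comp_assoc α vY sY rfl rfl (by lia), h₁, zsmul_comp,
    comp_assoc vX α₁ sY _ rfl (by lia), h₂, comp_zsmul,
    smul_smul, ← pow_add, mul_add, mul_one, ← comp_assoc vX sX α₂ rfl _ (by lia)]

variable {R : Type u} [Ring R] [HasExt.{w} (ModuleCat.{v} R)]
  {Ω B : ModuleCat.{v} R ⥤ ModuleCat.{v} R} {i : Ω ⟶ B} {p : B ⟶ 𝟭 (ModuleCat.{v} R)} {hw : i ≫ p = 0}
  (hS : (ShortComplex.mk i p hw).ShortExact)

/-- The class in `Ext ^ n` of the `n`-fold splice of short exact sequences `0 ⟶ Ω ⟶ B ⟶ 𝟭 ⟶ 0` of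
functors. -/
def syzygyClass (X : ModuleCat.{v} R) : (n : ℕ) → Ext.{w} X ((Ω.iter n).obj X) n
  | 0 => mk₀ (𝟙 X)
  | n + 1 => (syzygyClass X n).comp (hS.extClassAt ((Ω.iter n).obj X)) rfl

/-- Dimension shifting along a splice whose middle terms become projective under `F`. -/
lemma exists_syzygyClass_comp {D : Type u'} [Category.{v} D] [Abelian D] [HasExt.{w} D]
    (F : ModuleCat.{v} R ⥤ D) [F.Additive] [PreservesFiniteLimits F] [PreservesFiniteColimits F]
    (X : ModuleCat.{v} R) (hX : ∀ n, Projective (F.obj (B.obj ((Ω.iter n).obj X)))) {Y : D} (n q N : ℕ)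
    (h : n + q = N) (η : Ext (F.obj X) Y N) :
    ∃ β : Ext (F.obj ((Ω.iter n).obj X)) Y q,
      ((syzygyClass hS X n).mapExactFunctor F).comp β h = η := by
  induction n generalizing q with
  | zero =>
    obtain rfl : q = N := (zero_add q).symm.trans h
    refine ⟨η, ?_⟩
    have h1 : (syzygyClass hS X 0).mapExactFunctor F = mk₀ (𝟙 (F.obj X)) :=
      (mapExactFunctor_mk₀ F (𝟙 X)).trans (congrArg mk₀ (F.map_id X))
    rw [h1]
    exact mk₀_id_comp η
  | succ n ih =>
    -- One degree is held back for the next connecting class: `β` has degree `1 + q` and factors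
    -- through it because the image of the middle term under `F` is projective.
    obtain ⟨β, rfl⟩ := ih (1 + q) (by lia)
    have hT := (hS.map_of_exact ((evaluation _ _).obj ((Ω.iter n).obj X))).map_of_exact F
    have := hX n
    have hz : ∀ a, a = q + 1 → ∀ e : Ext (F.obj (B.obj ((Ω.iter n).obj X))) Y a, e = 0 := by
      rintro _ rfl e
      exact eq_zero_of_projective e
    obtain ⟨γ, hγ⟩ := contravariant_sequence_exact₃ hT Y β (hz _ (add_comm 1 q) _) rfl
    refine ⟨γ, Eq.trans ?_ (congrArg (((syzygyClass hS X n).mapExactFunctor F).comp · _) hγ)⟩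
    refine Eq.trans ?_ (comp_assoc _ hT.extClass γ rfl rfl (by lia))
    refine congrArg (fun ε => Ext.comp ε γ h) ((mapExactFunctor_comp F _ _ _).trans ?_)
    exact congrArg (((syzygyClass hS X n).mapExactFunctor F).comp · rfl)
      (mapExactFunctor_extClass F _)

variable [EnoughProjectives (ModuleCat.{v} R)] [Ω.Additive] [B.Additive]
  [PreservesFiniteLimits Ω] [PreservesFiniteColimits Ω]
  [PreservesFiniteLimits B] [PreservesFiniteColimits B]

include hS in
lemma comp_extClassAt {X Y : ModuleCat.{v} R} {n m : ℕ} (α : Ext X Y n) (h : n + 1 = m)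
    (h' : 1 + n = m) :
    α.comp (hS.extClassAt Y) h =
      (-1 : ℤ) ^ n • (hS.extClassAt X).comp (α.mapExactFunctor Ω) h' := by
  subst h
  have h1 := mapExactFunctor_comp_extClassAt hS α
  exact (congrArg (fun β : Ext X Y n => β.comp (hS.extClassAt Y) rfl)
    (mapExactFunctor_id α).symm).trans h1

/-- The class `α` is moved past the `n` connecting classes one at a time; each passage applies `Ω`
to it and contributes `(-1) ^ q`. -/
theorem comp_syzygyClass {X Y : ModuleCat.{v} R} {q : ℕ} (α : Ext X Y q) (n m : ℕ) (h : q + n = m)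
    (h' : n + q = m) :
    α.comp (syzygyClass hS Y n) h =
      (-1 : ℤ) ^ (q * n) • (syzygyClass hS X n).comp (α.mapExactFunctor (Ω.iter n)) h' := by
  induction n generalizing m with
  | zero =>
    obtain rfl : q = m := h
    rw [mul_zero, pow_zero, one_smul]
    refine (comp_mk₀_id α).trans ((mk₀_id_comp α).symm.trans ?_)
    exact congrArg (fun β => (mk₀ (𝟙 X)).comp β (zero_add q)) (mapExactFunctor_id α).symm
  | succ n ih =>
    have h2 := comp_extClassAt hS (α.mapExactFunctor (Ω.iter n)) rfl (add_comm 1 q)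
    have h3 := mapExactFunctor_mapExactFunctor (Ω.iter n) Ω α
    exact comp_comp_eq_smul (ih (q + n) rfl (add_comm n q)) (h2.trans (by rw [h3]; rfl)) h h'

/-- The natural transformation `h : Ω ^ n ⋙ F ⟶ 𝟭` turns the image under `F` of `syzygyClass` into
a family of classes from `F X` to `X`, which is natural up to the usual sign. -/
theorem mapExactFunctor_comp_syzygyClass_comp (F : ModuleCat.{v} R ⥤ ModuleCat.{v} R) [F.Additive]
    [PreservesFiniteLimits F] [PreservesFiniteColimits F] {n : ℕ} (τ : Ω.iter n ⋙ F ⟶ 𝟭 _)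
    {X Y : ModuleCat.{v} R} {q : ℕ} (α : Ext X Y q) (m : ℕ) (h : q + n = m) (h' : n + q = m) :
    (α.mapExactFunctor F).comp
        (((syzygyClass hS Y n).mapExactFunctor F).comp (mk₀ (τ.app Y)) (add_zero n)) h =
      (-1 : ℤ) ^ (q * n) •
        (((syzygyClass hS X n).mapExactFunctor F).comp (mk₀ (τ.app X)) (add_zero n)).comp α h' := by
  have h1 := congrArg (fun β => β.mapExactFunctor F) (comp_syzygyClass hS α n m h h')
  simp only [← Functor.mapExtAddHom_apply, map_zsmul] at h1
  simp only [Functor.mapExtAddHom_apply, mapExactFunctor_comp] at h1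
  -- Naturality of `τ` turns the image of `α` under `Ω ^ n` and then `F` back into `α`.
  have h2 := mapExactFunctor_naturality τ α
  rw [← mapExactFunctor_mapExactFunctor] at h2
  have h3 : α.mapExactFunctor (𝟭 (ModuleCat.{v} R)) = α := mapExactFunctor_id α
  rw [h3] at h2
  rw [← comp_assoc _ _ _ h (add_zero n) (by lia), h1, zsmul_comp, comp_assoc_of_third_deg_zero,
    comp_assoc_of_second_deg_zero]
  congr 2

/-- The iterates of a comparison between the composites of `Ω` and `G`. -/
def iterComparison {C : Type u} [Category.{v} C] {Ω : C ⥤ C} (G : C ⥤ C)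
    (τ : ∀ X, Ω.obj (G.obj X) ⟶ G.obj (Ω.obj X)) (X : C) :
    (n : ℕ) → ((Ω.iter n).obj (G.obj X) ⟶ G.obj ((Ω.iter n).obj X))
  | 0 => 𝟙 (G.obj X)
  | n + 1 => Ω.map (iterComparison G τ X n) ≫ τ ((Ω.iter n).obj X)

-- The inductive step of `syzygyClass_comp_iterComparison`, again for unrelated objects.
omit [HasExt.{w} (ModuleCat.{v} R)] [EnoughProjectives (ModuleCat.{v} R)] in
lemma comp_comp_mk₀_eq_mapExactFunctor {C : Type u} [Category.{v} C] [Abelian C] [HasExt.{w} C]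
    (G : C ⥤ C) [G.Additive] [PreservesFiniteLimits G] [PreservesFiniteColimits G]
    {X X₁ X₂ X₁' X₂' : C} {n : ℕ} {v : Ext X X₁ n} {s : Ext X₁ X₂ 1} {v' : Ext (G.obj X) X₁' n}
    {s' : Ext X₁' X₂' 1} {a : X₁' ⟶ G.obj X₁} {X₃ : C} {s'' : Ext (G.obj X₁) X₃ 1} {b : X₂' ⟶ X₃}
    {c : X₃ ⟶ G.obj X₂} (hv : v'.comp (mk₀ a) (add_zero n) = v.mapExactFunctor G)
    (h : (mk₀ a).comp s'' (zero_add 1) = s'.comp (mk₀ b) (add_zero 1))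
    (hc : s''.comp (mk₀ c) (add_zero 1) = s.mapExactFunctor G) :
    (v'.comp s' rfl).comp (mk₀ (b ≫ c)) (add_zero (n + 1)) = (v.comp s rfl).mapExactFunctor G := by
  rw [mapExactFunctor_comp, ← hv, ← hc, comp_assoc_of_second_deg_zero, ← mk₀_comp_mk₀,
    comp_assoc_of_third_deg_zero, ← comp_assoc_of_third_deg_zero s', ← h,
    comp_assoc_of_third_deg_zero]

/-- The image of `syzygyClass` under an exact functor compatible with the short exact sequence. -/
theorem syzygyClass_comp_iterComparison (G : ModuleCat.{v} R ⥤ ModuleCat.{v} R) [G.Additive]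
    [PreservesFiniteLimits G] [PreservesFiniteColimits G]
    (τ : ∀ X, Ω.obj (G.obj X) ⟶ G.obj (Ω.obj X)) (σ : ∀ X, B.obj (G.obj X) ⟶ G.obj (B.obj X))
    (hi : ∀ X, τ X ≫ G.map (i.app X) = i.app (G.obj X) ≫ σ X)
    (hp : ∀ X, σ X ≫ G.map (p.app X) = p.app (G.obj X)) (X : ModuleCat.{v} R) (n : ℕ) :
    (syzygyClass hS (G.obj X) n).comp (mk₀ (iterComparison G τ X n)) (add_zero n) =
      (syzygyClass hS X n).mapExactFunctor G := by
  induction n with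
  | zero =>
    refine (mk₀_comp_mk₀ _ _).trans (Eq.trans ?_ (mapExactFunctor_mk₀ _ _).symm)
    exact congrArg mk₀ ((Category.id_comp _).trans (G.map_id X).symm)
  | succ n ih =>
    have h1 := comp_extClassAt hS (mk₀ (iterComparison G τ X n)) rfl rfl
    rw [mapExactFunctor_mk₀, pow_zero, one_smul] at h1
    -- The morphism of short exact sequences is the identity on the right end, so `τ` carries one
    -- connecting class to the image of the other under `G`.
    have h2 := ShortComplex.ShortExact.extClass_naturality
      (hS.map_of_exact ((evaluation _ _).obj (G.obj ((Ω.iter n).obj X))))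
      ((hS.map_of_exact ((evaluation _ _).obj ((Ω.iter n).obj X))).map_of_exact G)
      { τ₁ := τ _, τ₂ := σ _, τ₃ := 𝟙 _, comm₁₂ := hi _,
        comm₂₃ := (hp _).trans (Category.comp_id _).symm }
    have h3 := mapExactFunctor_extClass G
      (hS.map_of_exact ((evaluation _ _).obj ((Ω.iter n).obj X)))
    exact comp_comp_mk₀_eq_mapExactFunctor G ih h1 (h2.trans ((mk₀_id_comp _).trans h3.symm))

end CategoryTheory

end Syzygies

/-! ### The exact syzygy functor on bimodules -/

namespace TwistedHochschild

open Limits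

section Syzygy

variable {k : Type u} [CommRing k] {Λ : Type v} [Ring Λ] [Algebra k Λ]

attribute [local instance] kModule kTower

lemma barStep_hom_ext {X Y : Bimod k Λ} {f g : barStep X ⟶ Y}
    (h : ∀ c x, f.hom (barStepTmul c x) = g.hom (barStepTmul c x)) : f = g := by
  ext z
  induction z using barStep_induction with
  | h0 => rw [map_zero, map_zero]
  | h1 c x => exact h c x
  | h2 x y hx hy => rw [map_add, map_add, hx, hy]

variable (k Λ) in
/-- The functor `X ↦ Λ ⊗ₖ X` on bimodules. -/
@[simps]
def barFunctor : Bimod k Λ ⥤ Bimod k Λ where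
  obj := barStep
  map := barStepMap
  map_id _ := barStep_hom_ext fun _ _ => rfl
  map_comp _ _ := barStep_hom_ext fun _ _ => rfl

instance : (barFunctor k Λ).Additive where
  map_add {_ _ f g} := barStep_hom_ext fun c x => barStepTmul_add c (f.hom x) (g.hom x)

/-- Being projective, `Λ` is flat over `k`, and exactness of bimodules can be tested on the
underlying `k`-modules. -/
lemma barFunctor_map_shortExact [Module.Projective k Λ] {T : ShortComplex (Bimod k Λ)}
    (hT : T.ShortExact) : (T.map (barFunctor k Λ)).ShortExact where
  exact := (ShortComplex.moduleCat_exact_iff _).2 fun x hx => by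
    have h : Function.Exact (homLin T.f) (homLin T.g) := by
      intro y
      exact ⟨(ShortComplex.moduleCat_exact_iff _).1 hT.exact y, by
        rintro ⟨a, rfl⟩; exact T.zero_apply a⟩
    exact (lTensor_exact Λ h hT.moduleCat_surjective_g x).1 hx
  mono_f := (ModuleCat.mono_iff_injective _).2
    (Module.Flat.lTensor_preserves_injective_linearMap (M := Λ) (homLin T.f)
      hT.moduleCat_injective_f)
  epi_g := (ModuleCat.epi_iff_surjective _).2
    (LinearMap.lTensor_surjective Λ (g := homLin T.g) hT.moduleCat_surjective_g)

lemma barFunctor_exact [Module.Projective k Λ] :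
    PreservesFiniteLimits (barFunctor k Λ) ∧ PreservesFiniteColimits (barFunctor k Λ) :=
  ((barFunctor k Λ).exact_tfae.out 0 3).1 fun _ hT => barFunctor_map_shortExact hT

instance [Module.Projective k Λ] : PreservesFiniteLimits (barFunctor k Λ) := barFunctor_exact.1

instance [Module.Projective k Λ] : PreservesFiniteColimits (barFunctor k Λ) := barFunctor_exact.2

variable (k Λ) in
/-- The action `Λ ⊗ₖ X ⟶ X` as a natural transformation. -/
def actTrans : barFunctor k Λ ⟶ 𝟭 (Bimod k Λ) where
  app := act
  naturality _ _ f := barStep_hom_ext fun _ x => (f.hom.map_smul _ x).symm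

/-- The kernel of the action `Λ ⊗ₖ X ⟶ X`. -/
def syzygy (X : Bimod k Λ) : Bimod k Λ := ModuleCat.of (Env k Λ) (LinearMap.ker (act X).hom)

/-- The inclusion of the kernel of the action `Λ ⊗ₖ X ⟶ X`. -/
def syzygyι (X : Bimod k Λ) : syzygy X ⟶ barStep X :=
  ModuleCat.ofHom (X := LinearMap.ker (act X).hom) (Y := barStep X)
    (LinearMap.ker (act X).hom).subtype

lemma syzygyι_injective (X : Bimod k Λ) : Function.Injective (syzygyι X).hom :=
  Subtype.val_injective

lemma act_syzygyι {X : Bimod k Λ} (w : syzygy X) : (act X).hom ((syzygyι X).hom w) = 0 := w.2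

lemma exists_syzygyι_eq {X : Bimod k Λ} (z : barStep X) (hz : (act X).hom z = 0) :
    ∃ w, (syzygyι X).hom w = z := ⟨⟨z, hz⟩, rfl⟩

/-- The map induced on the kernels of the actions. -/
def syzygyMap {X Y : Bimod k Λ} (f : X ⟶ Y) : syzygy X ⟶ syzygy Y :=
  ModuleCat.ofHom (X := LinearMap.ker (act X).hom) (Y := LinearMap.ker (act Y).hom)
   (((barStepMap f).hom ∘ₗ (syzygyι X).hom).codRestrict (LinearMap.ker (act Y).hom)
    fun w => (ConcreteCategory.congr_hom ((actTrans k Λ).naturality f) w.1).trans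
      ((congrArg f.hom w.2).trans (map_zero f.hom)))

lemma syzygy_hom_ext {X Y : Bimod k Λ} {f g : X ⟶ syzygy Y}
    (h : f ≫ syzygyι Y = g ≫ syzygyι Y) : f = g := by
  ext x
  exact syzygyι_injective Y (ConcreteCategory.congr_hom h x)

variable (k Λ) in
/-- The functor sending a bimodule `X` to the kernel of the action `Λ ⊗ₖ X ⟶ X`. -/
@[simps]
def syzygyFunctor : Bimod k Λ ⥤ Bimod k Λ where
  obj := syzygy
  map := syzygyMap
  map_id X := syzygy_hom_ext
    (congrArg (syzygyι X ≫ ·) ((barFunctor k Λ).map_id X))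
  map_comp {X _ _} f g := syzygy_hom_ext
    (congrArg (syzygyι X ≫ ·) ((barFunctor k Λ).map_comp f g))

instance : (syzygyFunctor k Λ).Additive where
  map_add {X _ f g} := syzygy_hom_ext
    (congrArg (syzygyι X ≫ ·) ((barFunctor k Λ).map_add (f := f) (g := g)))

variable (k Λ) in
/-- The inclusion of the kernel of the action, as a natural transformation. -/
def syzygyιTrans : syzygyFunctor k Λ ⟶ barFunctor k Λ where
  app := syzygyι
  naturality _ _ _ := rfl

variable (k Λ) in
lemma syzygyιTrans_actTrans : syzygyιTrans k Λ ≫ actTrans k Λ = 0 := by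
  ext X w
  exact act_syzygyι w

variable (k Λ) in
lemma syzygy_shortExact :
    (ShortComplex.mk _ _ (syzygyιTrans_actTrans k Λ)).ShortExact where
  exact := ShortComplex.exact_of_evaluation _ fun _ =>
    (ShortComplex.moduleCat_exact_iff _).2 fun z hz => exists_syzygyι_eq z hz
  mono_f := (NatTrans.mono_iff_mono_app _).2 fun _ =>
    (ModuleCat.mono_iff_injective _).2 (syzygyι_injective _)
  epi_g := (NatTrans.epi_iff_epi_app _).2 fun _ =>
    (ModuleCat.epi_iff_surjective _).2 fun x => ⟨barStepTmul 1 x, one_smul (Env k Λ) x⟩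

/-- The syzygy functor is the kernel of an epimorphism between the exact functors `Λ ⊗ₖ -` and `𝟭`.
-/
lemma syzygyFunctor_exact [Module.Projective k Λ] :
    PreservesFiniteLimits (syzygyFunctor k Λ) ∧ PreservesFiniteColimits (syzygyFunctor k Λ) := by
  have h := syzygy_shortExact k Λ
  have : (𝟭 (Bimod k Λ)).Additive := inferInstance
  exact @preservesFiniteLimits_and_colimits_of_shortExact _ _ _ _ _ _ h
    (inferInstanceAs (syzygyFunctor k Λ).Additive) (inferInstanceAs (barFunctor k Λ).Additive)
    (inferInstanceAs (𝟭 (Bimod k Λ)).Additive)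
    (inferInstanceAs (PreservesFiniteLimits (barFunctor k Λ)))
    (inferInstanceAs (PreservesFiniteColimits (barFunctor k Λ)))
    (inferInstanceAs (PreservesFiniteLimits (𝟭 (Bimod k Λ))))
    (inferInstanceAs (PreservesFiniteColimits (𝟭 (Bimod k Λ))))

instance [Module.Projective k Λ] : PreservesFiniteLimits (syzygyFunctor k Λ) :=
  syzygyFunctor_exact.1

instance [Module.Projective k Λ] : PreservesFiniteColimits (syzygyFunctor k Λ) :=
  syzygyFunctor_exact.2

end Syzygy

end TwistedHochschild

/-! ### Extending maps on the syzygies of `Λ` to the syzygies of every bimodule -/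

namespace TwistedHochschild

open Limits

section Extend

variable {k : Type u} [CommRing k] {Λ : Type v} [Ring Λ] [Algebra k Λ]

attribute [local instance] kModule kTower

/-- The left action of an element of `Λ` on a bimodule. -/
def lact (X : Bimod k Λ) (a : Λ) : X →ₗ[k] X := opLin X (a ⊗ₜ MulOpposite.op 1)

/-- The right action of an element of `Λ` on a bimodule. -/
def ract (X : Bimod k Λ) (b : Λ) : X →ₗ[k] X := opLin X (1 ⊗ₜ MulOpposite.op b)

lemma tmul_op_smul (X : Bimod k Λ) (a b : Λ) (x : X) :
    (a ⊗ₜ[k] MulOpposite.op b : Env k Λ) • x = lact X a (ract X b x) := by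
  change _ = (a ⊗ₜ[k] MulOpposite.op 1 : Env k Λ) • (1 ⊗ₜ[k] MulOpposite.op b : Env k Λ) • x
  rw [smul_smul, Algebra.TensorProduct.tmul_mul_tmul, mul_one, MulOpposite.op_one, one_mul]

lemma lact_ract (X : Bimod k Λ) (a b : Λ) (x : X) :
    lact X a (ract X b x) = ract X b (lact X a x) := by
  change (a ⊗ₜ[k] MulOpposite.op 1 : Env k Λ) • (1 ⊗ₜ[k] MulOpposite.op b : Env k Λ) • x =
    (1 ⊗ₜ[k] MulOpposite.op b : Env k Λ) • (a ⊗ₜ[k] MulOpposite.op 1 : Env k Λ) • x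
  simp only [smul_smul, Algebra.TensorProduct.tmul_mul_tmul, mul_one, MulOpposite.op_one, one_mul]

lemma lact_mul (X : Bimod k Λ) (a b : Λ) (x : X) : lact X (a * b) x = lact X a (lact X b x) := by
  change ((a * b) ⊗ₜ[k] MulOpposite.op 1 : Env k Λ) • x =
    (a ⊗ₜ[k] MulOpposite.op 1 : Env k Λ) • (b ⊗ₜ[k] MulOpposite.op 1 : Env k Λ) • x
  simp only [smul_smul, Algebra.TensorProduct.tmul_mul_tmul, mul_one, MulOpposite.op_one]

lemma hom_lact {X Y : Bimod k Λ} (f : X ⟶ Y) (a : Λ) (x : X) :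
    f.hom (lact X a x) = lact Y a (f.hom x) := f.hom.map_smul _ x

lemma hom_ract {X Y : Bimod k Λ} (f : X ⟶ Y) (a : Λ) (x : X) :
    f.hom (ract X a x) = ract Y a (f.hom x) := f.hom.map_smul _ x

lemma lact_regular (a : Λ) (x : regular k Λ) : lact (regular k Λ) a x = (a * (show Λ from x) : Λ) :=
  (regular_smul a 1 x).trans (mul_one (M := Λ) _)

lemma ract_regular (a : Λ) (x : regular k Λ) : ract (regular k Λ) a x = ((show Λ from x) * a : Λ) :=
  (regular_smul 1 a x).trans (congrArg (· * a) (one_mul _))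

lemma lact_barStepTmul {X : Bimod k Λ} (a c : Λ) (x : X) :
    lact (barStep X) a (barStepTmul c x) = barStepTmul (a * c) x :=
  (barStep_smul a 1 c x).trans (congrArg (barStepTmul (a * c)) (one_smul (Env k Λ) x))

lemma ract_barStepTmul {X : Bimod k Λ} (b c : Λ) (x : X) :
    ract (barStep X) b (barStepTmul c x) = barStepTmul c (ract X b x) :=
  (barStep_smul 1 b c x).trans (congrArg (barStepTmul · (ract X b x)) (one_mul c))

lemma regular_kModule_smul (r : k) (x : regular k Λ) : r • x = (r • (show Λ from x) : Λ) :=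
  (regular_smul (algebraMap k Λ r) 1 x).trans ((mul_one (M := Λ) _).trans
    (Algebra.smul_def (A := Λ) r _).symm)

lemma barStep_kModule_smul {X : Bimod k Λ} (r : k) (z : barStep X) :
    r • z = (r • (show Λ ⊗[k] X from z) : Λ ⊗[k] X) := by
  change barAction X (algebraMap k (Env k Λ) r) _ = _
  rw [AlgHom.commutes]
  rfl

/-- The identity from `Λ ⊗ₖ X` to the underlying module of `barStep X`. -/
def toBarStep (X : Bimod k Λ) : Λ ⊗[k] X ≃ₗ[k] barStep X where
  toFun z := z
  invFun z := z
  map_add' _ _ := rfl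
  map_smul' r z := (barStep_kModule_smul r z).symm
  left_inv _ := rfl
  right_inv _ := rfl

/-- The inclusion of the kernel of the action, as a `k`-linear map. -/
def syzygyInc (X : Bimod k Λ) : syzygy X →ₗ[k] Λ ⊗[k] X :=
  (toBarStep X).symm.toLinearMap ∘ₗ homLin (syzygyι X)

/-- The projection of `Λ ⊗ₖ X` onto the kernel of the action given by
`c ⊗ x ↦ c ⊗ x - 1 ⊗ c · x`. -/
def syzygyProj (X : Bimod k Λ) : barStep X →ₗ[k] syzygy X where
  toFun z := (⟨z - barStepTmul 1 ((act X).hom z), by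
    rw [LinearMap.mem_ker, map_sub, act_tmul, sub_eq_zero]
    exact (one_smul (Env k Λ) _).symm⟩ : LinearMap.ker (act X).hom)
  map_add' x y := syzygyι_injective X (by
    change x + y - barStepTmul 1 ((act X).hom (x + y)) =
      (x - barStepTmul 1 ((act X).hom x)) + (y - barStepTmul 1 ((act X).hom y))
    rw [map_add, barStepTmul_add]
    abel)
  map_smul' r x := syzygyι_injective X (by
    change r • x - barStepTmul 1 ((homLin (act X)) (r • x)) =
      r • (x - barStepTmul 1 ((act X).hom x))
    rw [map_smul, smul_sub]
    refine congrArg (r • x - ·) ?_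
    exact (TensorProduct.tmul_smul r (1 : Λ) _).trans (barStep_kModule_smul r _).symm)

lemma syzygyι_syzygyProj (X : Bimod k Λ) (z : barStep X) :
    (syzygyι X).hom (syzygyProj X z) = z - barStepTmul 1 ((act X).hom z) := rfl

lemma syzygyProj_syzygyι {X : Bimod k Λ} (w : syzygy X) :
    syzygyProj X ((syzygyι X).hom w) = w := syzygyι_injective X (by
  rw [syzygyι_syzygyProj, act_syzygyι]
  exact (congrArg _ (TensorProduct.tmul_zero _ (1 : Λ))).trans (sub_zero _))

lemma syzygyProj_ract {X : Bimod k Λ} (b : Λ) (z : barStep X) :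
    syzygyProj X (ract _ b z) = ract _ b (syzygyProj X z) := syzygyι_injective X (by
  rw [hom_ract, syzygyι_syzygyProj, syzygyι_syzygyProj, map_sub, hom_ract, ract_barStepTmul])

/-- The projection is right linear but not left linear. Its defect depends only on the image of `z`
under the action, so it vanishes on the syzygy; this is what makes `extend_comp_lact` work. -/
lemma syzygyProj_lact {X : Bimod k Λ} (a : Λ) (z : barStep X) :
    syzygyProj X (lact _ a z) =
      lact _ a (syzygyProj X z) + syzygyProj X (barStepTmul a ((act X).hom z)) :=
  syzygyι_injective X (by
  rw [map_add, hom_lact, syzygyι_syzygyProj, syzygyι_syzygyProj, syzygyι_syzygyProj, map_sub,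
    hom_lact, lact_barStepTmul, act_tmul, mul_one]
  change _ = _ - _ + (_ - barStepTmul 1 (lact X a _))
  abel)

section Projective

attribute [local instance] rightModule

/-- By the right linear projection the syzygy is a direct summand of `Λ ⊗ₖ X` as a right module. -/
lemma projective_right_syzygy {X : Bimod k Λ} (hX : Module.Projective Λᵐᵒᵖ (barStep X)) :
    Module.Projective Λᵐᵒᵖ (syzygy X) :=
  Module.Projective.of_split (P := syzygy X) (M := barStep X)
    { toFun := (syzygyι X).hom
      map_add' := (syzygyι X).hom.map_add
      map_smul' := fun b x => hom_ract (syzygyι X) b.unop x }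
    { toFun := syzygyProj X
      map_add' := (syzygyProj X).map_add
      map_smul' := fun b x => syzygyProj_ract b.unop x }
    (LinearMap.ext syzygyProj_syzygyι)

lemma projective_right_iter_syzygy [Module.Projective k Λ] (n : ℕ) :
    Module.Projective Λᵐᵒᵖ (((syzygyFunctor k Λ).iter n).obj (regular k Λ)) := by
  induction n with
  | zero => exact projective_right_regular
  | succ n ih => exact projective_right_syzygy (projective_right_barStep _ ih)

end Projective

variable (k Λ) in
lemma projective_barStep_iter_syzygy [Module.Projective k Λ] (n : ℕ) :
    Projective (barStep (((syzygyFunctor k Λ).iter n).obj (regular k Λ))) :=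
  projective_barStep _ (projective_right_iter_syzygy n)

/-- The `n`-th syzygy of a bimodule. -/
abbrev syzygyIter (n : ℕ) (X : Bimod k Λ) : Bimod k Λ := ((syzygyFunctor k Λ).iter n).obj X

/-- The map `x ↦ h (c ⊗ x - 1 ⊗ c · x)`. -/
def slice {X Y : Bimod k Λ} (h : syzygy X →ₗ[k] Y) : Λ →ₗ[k] X →ₗ[k] Y :=
  TensorProduct.curry (h ∘ₗ syzygyProj X ∘ₗ (toBarStep X).toLinearMap)

lemma slice_apply {X Y : Bimod k Λ} (h : syzygy X →ₗ[k] Y) (c : Λ) (x : X) :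
    slice h c x = h (syzygyProj X (barStepTmul c x)) := rfl

/-- The extension of a `k`-linear map defined on the kernel of the action. -/
def extendStep {X Y Z W : Bimod k Λ} (E : (X →ₗ[k] Y) →ₗ[k] (Z →ₗ[k] W)) :
    (syzygy X →ₗ[k] Y) →ₗ[k] (Λ ⊗[k] Z →ₗ[k] W) where
  toFun h := TensorProduct.lift (E ∘ₗ slice h)
  map_add' h h' := TensorProduct.ext' fun c z => LinearMap.congr_fun (E.map_add (slice h c) (slice h' c)) z
  map_smul' r h := TensorProduct.ext' fun c z => LinearMap.congr_fun (E.map_smul r (slice h c)) z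

lemma lact_add (X : Bimod k Λ) (a b : Λ) (x : X) : lact X (a + b) x = lact X a x + lact X b x :=
  (congrArg (fun e : Env k Λ => e • x) (TensorProduct.add_tmul a b _)).trans (add_smul _ _ _)

lemma lact_smul (X : Bimod k Λ) (r : k) (a : Λ) (x : X) : lact X (r • a) x = r • lact X a x :=
  (congrArg (fun e : Env k Λ => opLin X e x) (TensorProduct.smul_tmul' r a _)).symm.trans
    (by rw [map_smul]; rfl)

/-- A `k`-linear map from the `n`-th syzygy of `Λ` to `Λ` induces one from the `n`-th syzygy of any
bimodule `X` to `X`; after the identification with tensor products over `Λ` it is tensoring with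
`X` over `Λ`. -/
def extend (X : Bimod k Λ) :
    (n : ℕ) → (syzygyIter n (regular k Λ) →ₗ[k] regular k Λ) →ₗ[k] (syzygyIter n X →ₗ[k] X)
  -- A right linear `g` is left multiplication by `g 1`, so tensoring it with `X` over `Λ` is the
  -- action of `g 1`.
  | 0 => LinearMap.mk₂ k (fun (g : regular k Λ →ₗ[k] regular k Λ) (x : X) => lact X (g (1 : Λ)) x)
      (fun _ _ x => lact_add X _ _ x)
      (fun r g x => (congrArg (lact X · x) (regular_kModule_smul r (g (1 : Λ)))).trans
        (lact_smul X r _ x))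
      (fun _ x y => map_add _ x y) (fun r _ x => map_smul _ r x)
  -- On `c ⊗ z` the extension of `g` is the extension of its slice at `c`, evaluated at `z`; the
  -- result is restricted from `Λ ⊗ₖ Ωⁿ X` to the kernel of the action.
  | n + 1 => LinearMap.lcomp k X (syzygyInc (syzygyIter n X)) ∘ₗ extendStep (extend X n)

/-- Keeps the inductions on `extend` within right linear maps. -/
lemma slice_ract {X Y : Bimod k Λ} {h : syzygy X →ₗ[k] Y}
    (hh : ∀ b w, h (ract _ b w) = ract _ b (h w)) (c b : Λ) (x : X) :
    slice h c (ract X b x) = ract Y b (slice h c x) := by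
  rw [slice_apply, slice_apply, ← hh, ← syzygyProj_ract, ract_barStepTmul]

lemma slice_comp_lact {X Y : Bimod k Λ} (h : syzygy X →ₗ[k] Y) (b c : Λ) :
    slice (h ∘ₗ lact _ b) c = slice h (b * c) - slice h b ∘ₗ lact X c := by
  ext x
  rw [LinearMap.sub_apply, LinearMap.comp_apply, slice_apply, slice_apply, slice_apply,
    LinearMap.comp_apply, eq_sub_iff_add_eq, ← map_add, ← lact_barStepTmul]
  exact congrArg h (syzygyProj_lact b (barStepTmul c x)).symm

lemma tensor_induction {X Y : Bimod k Λ} {f g : Λ ⊗[k] X → Y} (hf : ∀ x y, f (x + y) = f x + f y)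
    (hg : ∀ x y, g (x + y) = g x + g y) (h : ∀ c x, f (c ⊗ₜ x) = g (c ⊗ₜ x)) (z : Λ ⊗[k] X) :
    f z = g z := by
  induction z with
  | zero =>
    have h1 := hf 0 0
    have h2 := hg 0 0
    rw [add_zero, left_eq_add] at h1 h2
    rw [h1, h2]
  | tmul c x => exact h c x
  | add x y hx hy => rw [hf, hg, hx, hy]

lemma extend_ract (X : Bimod k Λ) (n : ℕ) (g : syzygyIter n (regular k Λ) →ₗ[k] regular k Λ) (b : Λ)
    (x : syzygyIter n X) : extend X n g (ract _ b x) = ract X b (extend X n g x) := by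
  induction n with
  | zero => exact lact_ract X _ b x
  | succ n ih =>
    refine tensor_induction
      (f := fun z => extendStep (extend X n) g ((toBarStep _).symm (ract _ b (toBarStep _ z))))
      (g := fun z => ract X b (extendStep (extend X n) g z)) ?_ ?_ ?_
      (syzygyInc (syzygyIter n X) x)
    · intro x y
      simp only [map_add]
    · intro x y
      simp only [map_add]
    · intro c x
      refine Eq.trans ?_ (ih (slice g c) x)
      exact congrArg (fun y => extendStep (extend X n) g ((toBarStep _).symm y))
        (ract_barStepTmul b c x)

lemma extend_lact_comp (X : Bimod k Λ) (n : ℕ) (g : syzygyIter n (regular k Λ) →ₗ[k] regular k Λ)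
    (a : Λ) (x : syzygyIter n X) :
    extend X n (lact _ a ∘ₗ g) x = lact X a (extend X n g x) := by
  induction n with
  | zero =>
    exact (congrArg (lact X · x) (lact_regular a (g (1 : Λ)))).trans (lact_mul X a _ x)
  | succ n ih =>
    refine tensor_induction
      (f := fun z => extendStep (extend X n) (lact _ a ∘ₗ g) z)
      (g := fun z => lact X a (extendStep (extend X n) g z)) ?_ ?_ ?_
      (syzygyInc (syzygyIter n X) x)
    · intro x y
      simp only [map_add]
    · intro x y
      simp only [map_add]
    · intro c x
      exact ih (slice g c) x

/-- In degree 0 this is `g (a * 1) = g (1 * a) = g 1 * a`, which needs right linearity. In higher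
degrees the slices of `g` composed with `a` differ from the expected ones by the defect of
`syzygyProj_lact`, which vanishes on syzygies. -/
lemma extend_comp_lact (X : Bimod k Λ) (n : ℕ) (g : syzygyIter n (regular k Λ) →ₗ[k] regular k Λ)
    (hg : ∀ b x, g (ract _ b x) = ract _ b (g x)) (a : Λ) (x : syzygyIter n X) :
    extend X n (g ∘ₗ lact _ a) x = extend X n g (lact _ a x) := by
  induction n generalizing a with
  | zero =>
    refine Eq.trans (congrArg (lact X · x) ?_) (lact_mul X (g (1 : Λ)) a x)
    have h1 : lact (regular k Λ) a (1 : Λ) = ract (regular k Λ) a (1 : Λ) :=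
      (lact_regular a _).trans (Eq.trans ((mul_one (M := Λ) a).trans (one_mul (M := Λ) a).symm)
        (ract_regular a (1 : Λ)).symm)
    exact (congrArg g h1).trans ((hg a (1 : Λ)).trans (ract_regular a _))
  | succ n ih =>
    -- On all of `Λ ⊗ₖ Ωⁿ X` the identity holds only with the second summand of `f` added; that
    -- summand factors through the action and is zero at `x`.
    have h1 : _ = _ := tensor_induction
      (f := fun z => extendStep (extend X n) (g ∘ₗ lact _ a) z +
        extend X n (slice g a) ((act _).hom (toBarStep _ z)))
      (g := fun z => extendStep (extend X n) g ((toBarStep _).symm (lact _ a (toBarStep _ z))))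
      ?_ ?_ ?_ (syzygyInc (syzygyIter n X) x)
    · refine (add_zero _).symm.trans (Eq.trans ?_ h1)
      refine congrArg (_ + ·) ?_
      exact (map_zero (extend X n (slice g a))).symm.trans
        (congrArg (extend X n (slice g a)) (act_syzygyι x).symm)
    · intro x y
      simp only [map_add]
      abel
    · intro x y
      simp only [map_add]
    · intro c x
      have h2 : extend X n (slice (g ∘ₗ lact _ a) c) x = extend X n (slice g (a * c)) x -
          extend X n (slice g a) (lact _ c x) := by
        have h3 := slice_comp_lact g a c
        refine (congrArg (fun e => extend X n e x) h3).trans ?_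
        rw [map_sub, LinearMap.sub_apply]
        exact congrArg (extend X n (slice g (a * c)) x - ·) (ih _ (slice_ract hg a) c x)
      refine (eq_sub_iff_add_eq.1 h2).trans ?_
      exact (congrArg (fun y => extendStep (extend X n) g ((toBarStep _).symm y))
        (lact_barStepTmul a c x)).symm

lemma extend_map {X Y : Bimod k Λ} (f : X ⟶ Y) (n : ℕ)
    (g : syzygyIter n (regular k Λ) →ₗ[k] regular k Λ) (x : syzygyIter n X) :
    extend Y n g ((((syzygyFunctor k Λ).iter n).map f).hom x) = f.hom (extend X n g x) := by
  induction n with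
  | zero => exact (hom_lact f _ x).symm
  | succ n ih =>
    refine tensor_induction
      (f := fun z => extendStep (extend Y n) g ((toBarStep _).symm
        ((barStepMap (((syzygyFunctor k Λ).iter n).map f)).hom (toBarStep _ z))))
      (g := fun z => f.hom (extendStep (extend X n) g z)) ?_ ?_ ?_
      (syzygyInc (syzygyIter n X) x)
    · intro x y
      simp only [map_add]
    · intro x y
      simp only [map_add]
    · intro c x
      exact ih (slice g c) x

/-- Tensoring with `Λ` over `Λ` changes nothing. In the inductive step the slices recombine to `g`
composed with the projection, which is the identity on the syzygy. -/
lemma extend_regular (n : ℕ) (g : syzygyIter n (regular k Λ) →ₗ[k] regular k Λ)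
    (hg : ∀ b x, g (ract _ b x) = ract _ b (g x)) : extend (regular k Λ) n g = g := by
  induction n with
  | zero =>
    ext x
    have h1 : ract (regular k Λ) x (1 : Λ) = x :=
      (ract_regular (Λ := Λ) x (1 : Λ)).trans (one_mul (M := Λ) x)
    refine (lact_regular (Λ := Λ) (g (1 : Λ)) x).trans ?_
    exact (ract_regular (Λ := Λ) x (g (1 : Λ))).symm.trans ((hg x (1 : Λ)).symm.trans
      (congrArg g h1))
  | succ n ih =>
    ext x
    refine Eq.trans ?_ (congrArg g (syzygyProj_syzygyι x))
    refine tensor_induction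
      (f := fun z => extendStep (extend (regular k Λ) n) g z)
      (g := fun z => g (syzygyProj _ (toBarStep _ z))) ?_ ?_ ?_ (syzygyInc _ x)
    · intro x y
      simp only [map_add]
    · intro x y
      exact (congrArg g (by simp only [map_add]; rfl)).trans (map_add g _ _)
    · intro c x
      exact LinearMap.congr_fun (ih (slice g c) (slice_ract hg c)) x

end Extend

end TwistedHochschild

/-! ### The extension as a natural transformation, and its behaviour under right twists -/

namespace TwistedHochschild

open Limits

section Families

variable {k : Type u} [CommRing k] {Λ : Type v} [Ring Λ] [Algebra k Λ]

attribute [local instance] kModule kTower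

/-- An additive map compatible with the two-sided actions is a morphism of bimodules. -/
def homMk {X Y : Bimod k Λ} (e : X →+ Y)
    (h : ∀ (a b : Λ) (x : X), e ((a ⊗ₜ[k] MulOpposite.op b : Env k Λ) • x) =
      (a ⊗ₜ[k] MulOpposite.op b : Env k Λ) • e x) : X ⟶ Y :=
  ModuleCat.ofHom
    { toFun := e
      map_add' := e.map_add
      map_smul' := fun r x => by
        induction r using env_induction with
        | h0 =>
          exact ((congrArg e (zero_smul (Env k Λ) x)).trans e.map_zero).trans
            (zero_smul (Env k Λ) (e x)).symm
        | h1 a b => exact h a b x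
        | h2 r s hr hs =>
          exact ((congrArg e (add_smul r s x)).trans (e.map_add _ _)).trans
            ((congrArg₂ (· + ·) hr hs).trans (add_smul r s (e x)).symm) }

lemma twist_kModule_smul (φ ρ : Λ ≃ₐ[k] Λ) (X : Bimod k Λ) (r : k) (x : (twist φ ρ).obj X) :
    r • x = (r • (show X from x) : X) :=
  congrArg (fun e : Env k Λ => e • (show X from x))
    ((Algebra.TensorProduct.congr φ (AlgEquiv.op ρ)).commutes r)

/-- The identity from a twist of `X` to `X`, as a `k`-linear map. -/
def untwist (φ ρ : Λ ≃ₐ[k] Λ) (X : Bimod k Λ) : (twist φ ρ).obj X ≃ₗ[k] X where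
  toFun x := x
  invFun x := x
  map_add' _ _ := rfl
  map_smul' r x := twist_kModule_smul φ ρ X r x
  left_inv _ := rfl
  right_inv _ := rfl

/-- A morphism from a twisted bimodule, as a `k`-linear map. -/
def twistHomLin {φ ρ : Λ ≃ₐ[k] Λ} {X Y : Bimod k Λ} (h : (twist φ ρ).obj X ⟶ Y) : X →ₗ[k] Y where
  toFun x := h.hom (show (twist φ ρ).obj X from x)
  map_add' x y := h.hom.map_add x y
  map_smul' r x := (congrArg h.hom (twist_kModule_smul φ ρ X r x).symm).trans
    ((homLin h).map_smul r _)

lemma twistHomLin_ract {φ : Λ ≃ₐ[k] Λ} {X Y : Bimod k Λ} (h : (twist φ 1).obj X ⟶ Y) (b : Λ)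
    (x : X) : twistHomLin h (ract X b x) = ract Y b (twistHomLin h x) := by
  refine Eq.trans (congrArg h.hom ?_) (hom_ract h b (show (twist φ 1).obj X from x))
  refine Eq.trans ?_ (twist_smul φ 1 X 1 b x).symm
  rw [map_one]
  rfl

lemma twistHomLin_lact {φ : Λ ≃ₐ[k] Λ} {X Y : Bimod k Λ} (h : (twist φ 1).obj X ⟶ Y) (a : Λ)
    (x : X) : twistHomLin h (lact X (φ a) x) = lact Y a (twistHomLin h x) := by
  refine Eq.trans (congrArg h.hom ?_) (hom_lact h a (show (twist φ 1).obj X from x))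
  exact (twist_smul φ 1 X a 1 x).symm

/-- The natural transformation extending a morphism from the twisted `n`-th syzygy of `Λ` to
`Λ`. -/
def extendTrans {φ : Λ ≃ₐ[k] Λ} {n : ℕ}
    (h : (twist φ 1).obj (syzygyIter n (regular k Λ)) ⟶ regular k Λ) :
    (syzygyFunctor k Λ).iter n ⋙ twist φ 1 ⟶ 𝟭 (Bimod k Λ) where
  app X := homMk (X := (twist φ 1).obj (syzygyIter n X))
    (extend X n (twistHomLin h)).toAddMonoidHom fun a b x => by
      change extend X n (twistHomLin h)
        ((φ a ⊗ₜ[k] MulOpposite.op b : Env k Λ) • (show syzygyIter n X from x)) = _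
      -- The twisted left action is moved from the syzygy of `X` to that of `Λ`, where linearity of
      -- `h` turns `φ a` into `a` acting on the values.
      rw [tmul_op_smul, ← extend_comp_lact X n _ (twistHomLin_ract h)]
      refine Eq.trans ?_ (tmul_op_smul X a b _).symm
      have h1 : twistHomLin h ∘ₗ lact _ (φ a) = lact _ a ∘ₗ twistHomLin h :=
        LinearMap.ext (twistHomLin_lact h a)
      rw [h1, extend_lact_comp, extend_ract]
      rfl
  naturality X Y f := by
    ext x
    exact extend_map f n (twistHomLin h) x

lemma extendTrans_app_regular {φ : Λ ≃ₐ[k] Λ} {n : ℕ}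
    (h : (twist φ 1).obj (syzygyIter n (regular k Λ)) ⟶ regular k Λ) :
    (extendTrans h).app (regular k Λ) = h := by
  ext x
  exact LinearMap.congr_fun (extend_regular n _ (twistHomLin_ract h)) x

/-- The identity from `Λ ⊗ₖ X_ρ` to `(Λ ⊗ₖ X)_ρ`, as a `k`-linear map. -/
def barTwistLin (ρ : Λ ≃ₐ[k] Λ) (X : Bimod k Λ) :
    Λ ⊗[k] (twist 1 ρ).obj X →ₗ[k] (twist 1 ρ).obj (barStep X) :=
  (untwist 1 ρ (barStep X)).symm.toLinearMap ∘ₗ (toBarStep X).toLinearMap ∘ₗ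
    (untwist 1 ρ X).toLinearMap.lTensor Λ

lemma barTwistLin_tmul (ρ : Λ ≃ₐ[k] Λ) (X : Bimod k Λ) (c : Λ) (x : (twist 1 ρ).obj X) :
    barTwistLin ρ X (c ⊗ₜ x) = (untwist 1 ρ (barStep X)).symm (barStepTmul c (untwist 1 ρ X x)) :=
  rfl

lemma untwist_smul (φ ρ : Λ ≃ₐ[k] Λ) (X : Bimod k Λ) (a b : Λ) (x : (twist φ ρ).obj X) :
    untwist φ ρ X ((a ⊗ₜ[k] MulOpposite.op b : Env k Λ) • x) =
      (φ a ⊗ₜ[k] MulOpposite.op (ρ b) : Env k Λ) • untwist φ ρ X x := rfl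

/-- The identity `Λ ⊗ₖ X_ρ ⟶ (Λ ⊗ₖ X)_ρ`. -/
def barTwist (ρ : Λ ≃ₐ[k] Λ) (X : Bimod k Λ) :
    barStep ((twist 1 ρ).obj X) ⟶ (twist 1 ρ).obj (barStep X) :=
  barStepHom (X := (twist 1 ρ).obj X) (Y := (twist 1 ρ).obj (barStep X)) (barTwistLin ρ X)
    (fun a b c x => by
      rw [barTwistLin_tmul, barTwistLin_tmul, LinearEquiv.symm_apply_eq, untwist_smul,
        untwist_smul, LinearEquiv.apply_symm_apply, barStep_smul, map_one]
      rfl)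

lemma barTwist_act (ρ : Λ ≃ₐ[k] Λ) (X : Bimod k Λ) :
    barTwist ρ X ≫ (twist 1 ρ).map (act X) = act ((twist 1 ρ).obj X) := by
  refine barStep_hom_ext fun c x => ?_
  refine Eq.trans ?_ (twist_smul 1 ρ X c 1 x).symm
  rw [map_one]
  rfl

/-- The identity map from the syzygy of `X_ρ` to the twist by `ρ` of the syzygy of `X`. -/
def syzygyTwist (ρ : Λ ≃ₐ[k] Λ) (X : Bimod k Λ) :
    syzygy ((twist 1 ρ).obj X) ⟶ (twist 1 ρ).obj (syzygy X) :=
  homMk (Y := (twist 1 ρ).obj (syzygy X))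
    { toFun := fun w => (⟨(barTwist ρ X).hom ((syzygyι _).hom w),
        (ConcreteCategory.congr_hom (barTwist_act ρ X) _).trans (act_syzygyι w)⟩ :
          LinearMap.ker (act X).hom)
      map_zero' := syzygyι_injective X ((congrArg (barTwist ρ X).hom (map_zero (syzygyι _).hom)).trans
        (map_zero (barTwist ρ X).hom))
      map_add' := fun x y => syzygyι_injective X
        ((congrArg (barTwist ρ X).hom (map_add (syzygyι _).hom x y)).trans
        (map_add (barTwist ρ X).hom _ _)) }
    fun _ _ x => syzygyι_injective X
        ((congrArg (barTwist ρ X).hom (map_smul (syzygyι _).hom _ x)).trans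
        (map_smul (barTwist ρ X).hom _ _))

lemma syzygyTwist_syzygyι (ρ : Λ ≃ₐ[k] Λ) (X : Bimod k Λ) :
    syzygyTwist ρ X ≫ (twist 1 ρ).map (syzygyι X) = syzygyι _ ≫ barTwist ρ X := rfl

/-- The formulas for `extend` involve only the left action on `X`, which a right twist leaves
unchanged. -/
lemma extend_twist (ρ : Λ ≃ₐ[k] Λ) (X : Bimod k Λ) (n : ℕ)
    (g : syzygyIter n (regular k Λ) →ₗ[k] regular k Λ) (x : syzygyIter n ((twist 1 ρ).obj X)) :
    extend ((twist 1 ρ).obj X) n g x =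
      extend X n g ((iterComparison (Ω := syzygyFunctor k Λ) (twist 1 ρ) (syzygyTwist ρ) X n).hom x) := by
  induction n with
  | zero =>
    refine (twist_smul 1 ρ X (g (1 : Λ)) 1 x).trans ?_
    rw [map_one]
    rfl
  | succ n ih =>
    refine tensor_induction
      (f := extendStep (extend ((twist 1 ρ).obj X) n) g)
      (g := extendStep (extend X n) g ∘ₗ (toBarStep _).symm.toLinearMap ∘ₗ
        (untwist 1 ρ _).toLinearMap ∘ₗ homLin (barTwist ρ _) ∘ₗ
        homLin (barStepMap (iterComparison (Ω := syzygyFunctor k Λ) (twist 1 ρ)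
          (syzygyTwist ρ) X n)) ∘ₗ (toBarStep _).toLinearMap) ?_ ?_ ?_ (syzygyInc _ x)
    · exact map_add _
    · exact map_add _
    · intro c x
      exact ih (slice g c) x

/-- The identity from the left twist by `φ` of the right twist by `ρ` to the right twist by `ρ` of
the left twist by `φ`, as a `k`-linear equivalence. -/
def twistCommLin (φ ρ : Λ ≃ₐ[k] Λ) (X : Bimod k Λ) :
    (twist φ 1).obj ((twist 1 ρ).obj X) ≃ₗ[k] (twist 1 ρ).obj ((twist φ 1).obj X) :=
  untwist φ 1 ((twist 1 ρ).obj X) ≪≫ₗ untwist 1 ρ X ≪≫ₗ (untwist φ 1 X).symm ≪≫ₗ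
      (untwist 1 ρ ((twist φ 1).obj X)).symm

lemma twistCommLin_smul (φ ρ : Λ ≃ₐ[k] Λ) (X : Bimod k Λ) (a b : Λ)
    (x : (twist φ 1).obj ((twist 1 ρ).obj X)) :
    twistCommLin φ ρ X ((a ⊗ₜ[k] MulOpposite.op b : Env k Λ) • x) =
      (a ⊗ₜ[k] MulOpposite.op b : Env k Λ) • twistCommLin φ ρ X x := by
  rw [twistCommLin, LinearEquiv.trans_apply, LinearEquiv.trans_apply, LinearEquiv.trans_apply,
    LinearEquiv.symm_apply_eq, LinearEquiv.symm_apply_eq, untwist_smul, untwist_smul,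
    untwist_smul, untwist_smul, LinearEquiv.trans_apply, LinearEquiv.trans_apply,
    LinearEquiv.trans_apply, LinearEquiv.apply_symm_apply, LinearEquiv.apply_symm_apply]
  rfl

/-- The components of `twistComm`. -/
def twistCommApp (φ ρ : Λ ≃ₐ[k] Λ) (X : Bimod k Λ) :
    (twist φ 1).obj ((twist 1 ρ).obj X) ⟶ (twist 1 ρ).obj ((twist φ 1).obj X) :=
  homMk (twistCommLin φ ρ X).toLinearMap.toAddMonoidHom (twistCommLin_smul φ ρ X)

/-- The left twist by `φ` commutes with the right twist by `ρ`. -/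
def twistComm (φ ρ : Λ ≃ₐ[k] Λ) : twist 1 ρ ⋙ twist φ 1 ⟶ twist φ 1 ⋙ twist 1 ρ where
  app := twistCommApp φ ρ
  naturality _ _ _ := rfl

end Families

end TwistedHochschild

/-! ### The family of classes attached to a class over `Λ` -/

namespace TwistedHochschild

open Limits

section NaturalClass

variable {k : Type u} [CommRing k] {Λ : Type v} [Ring Λ] [Algebra k Λ] [Module.Projective k Λ]
  {φ : Λ ≃ₐ[k] Λ} {n : ℕ}

/-- The class over the bimodule `X` given by a morphism from the twisted `n`-th syzygy of `Λ`
to `Λ`. -/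
def naturalClass (h : (twist φ 1).obj (syzygyIter n (regular k Λ)) ⟶ regular k Λ) (X : Bimod k Λ) :
    Ext.{v} ((twist φ 1).obj X) X n :=
  ((syzygyClass (syzygy_shortExact k Λ) X n).mapExactFunctor (twist φ 1)).comp
    (Ext.mk₀ ((extendTrans h).app X)) (add_zero n)

/-- Dimension shifting along the splice: the bimodules `Λ ⊗ₖ Ωⁱ Λ` are projective and remain so
after twisting, hence `η` comes from a morphism on the last syzygy, which `extendTrans` restores at
`Λ`. -/
lemma exists_naturalClass_regular (η : Ext.{v} ((twist φ 1).obj (regular k Λ)) (regular k Λ) n) :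
    ∃ h : (twist φ 1).obj (syzygyIter n (regular k Λ)) ⟶ regular k Λ,
      naturalClass h (regular k Λ) = η := by
  obtain ⟨β, hβ⟩ := exists_syzygyClass_comp (syzygy_shortExact k Λ) (twist φ 1) (regular k Λ)
    (fun n => Functor.projective_obj_of_projective _ (projective_barStep_iter_syzygy k Λ n))
    n 0 n (add_zero n) η
  obtain ⟨h, rfl⟩ := (Ext.mk₀_bijective _ _).2 β
  refine ⟨h, Eq.trans ?_ hβ⟩
  exact congrArg (fun g => Ext.comp _ (Ext.mk₀ g) (add_zero n)) (extendTrans_app_regular h)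

/-- The source of graded commutativity: both the splice and the extension of `h` are natural, the
splice up to the sign. -/
lemma mapExactFunctor_comp_naturalClass
    (h : (twist φ 1).obj (syzygyIter n (regular k Λ)) ⟶ regular k Λ) {X Y : Bimod k Λ} {q m : ℕ}
    (θ : Ext.{v} X Y q) (hm : q + n = m) (hm' : n + q = m) :
    (θ.mapExactFunctor (twist φ 1)).comp (naturalClass h Y) hm =
      (-1 : ℤ) ^ (q * n) • (naturalClass h X).comp θ hm' :=
  mapExactFunctor_comp_syzygyClass_comp (syzygy_shortExact k Λ) (twist φ 1) (extendTrans h) θ m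
    hm hm'

/-- The splice (`h1`) and the extension of `h` (`h2`) are each compatible with right twists, and
left twists commute with right twists (`h3`). -/
lemma naturalClass_twist
    (h : (twist φ 1).obj (syzygyIter n (regular k Λ)) ⟶ regular k Λ) (ρ : Λ ≃ₐ[k] Λ)
    (X : Bimod k Λ) :
    naturalClass h ((twist 1 ρ).obj X) = (Ext.mk₀ (twistCommApp φ ρ X)).comp
      ((naturalClass h X).mapExactFunctor (twist 1 ρ)) (zero_add n) := by
  have h1 := syzygyClass_comp_iterComparison (syzygy_shortExact k Λ) (twist 1 ρ) (syzygyTwist ρ)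
    (barTwist ρ) (syzygyTwist_syzygyι ρ) (barTwist_act ρ) X n
  have h2 : (extendTrans h).app ((twist 1 ρ).obj X) =
      (twist φ 1).map (iterComparison (Ω := syzygyFunctor k Λ) (twist 1 ρ) (syzygyTwist ρ) X n) ≫
        twistCommApp φ ρ (syzygyIter n X) ≫ (twist 1 ρ).map ((extendTrans h).app X) := by
    ext x
    exact extend_twist ρ X n (twistHomLin h) x
  have h3 := Ext.mapExactFunctor_naturality (twistComm φ ρ)
    (syzygyClass (syzygy_shortExact k Λ) X n)
  rw [← Ext.mapExactFunctor_mapExactFunctor, ← Ext.mapExactFunctor_mapExactFunctor] at h3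
  have h4 := congrArg (fun e => e.mapExactFunctor (twist φ 1)) h1
  simp only [Ext.mapExactFunctor_comp, Ext.mapExactFunctor_mk₀] at h4
  rw [naturalClass, h2, ← Ext.mk₀_comp_mk₀, ← Ext.mk₀_comp_mk₀, naturalClass,
    Ext.mapExactFunctor_comp, Ext.mapExactFunctor_mk₀]
  rw [← Ext.comp_assoc_of_third_deg_zero, ← Ext.comp_assoc_of_third_deg_zero,
    ← Ext.comp_assoc_of_third_deg_zero]
  have aux : ∀ {A A' A₁ A₂ A₃ A₄ : Bimod k Λ} {a : Ext.{v} A A₁ n} {b : A₁ ⟶ A₂} {c : Ext.{v} A A₂ n}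
      {d : A₂ ⟶ A₃} {d' : A ⟶ A'} {c' : Ext.{v} A' A₃ n} (e : A₃ ⟶ A₄)
      (_ : a.comp (Ext.mk₀ b) (add_zero n) = c)
      (_ : c.comp (Ext.mk₀ d) (add_zero n) = (Ext.mk₀ d').comp c' (zero_add n)),
      ((a.comp (Ext.mk₀ b) (add_zero n)).comp (Ext.mk₀ d) (add_zero n)).comp (Ext.mk₀ e)
        (add_zero n) = ((Ext.mk₀ d').comp c' (zero_add n)).comp (Ext.mk₀ e) (add_zero n) := by
    intro _ _ _ _ _ _ _ _ _ _ _ _ _ h5 h6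
    rw [h5, h6]
  exact aux _ h4 h3

end NaturalClass

end TwistedHochschild

/-! ### Comparison maps between twisted bar resolutions -/

namespace TwistedHochschild

open Limits ProjectiveResolution

section Compare

attribute [local instance] kModule kTower

variable {k : Type u} [CommRing k] {Λ : Type v} [Ring Λ] [Algebra k Λ]

lemma twistedBarResolution_π [Module.Projective k Λ] (ψ : Λ ≃ₐ[k] Λ) (m : ℕ) :
    (show twistedBar ψ m 0 ⟶ twisted ψ m from (twistedBarResolution ψ m).π.f 0) =
      (twist (ψ ^ m) 1).map (barDelta k Λ 0) := by
  rw [← barAugmentation_f_zero]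
  refine Eq.trans (b := (twist (ψ ^ m) 1).map ((barAugmentation k Λ).f 0) ≫
    ((HomologicalComplex.singleMapHomologicalComplex (twist (ψ ^ m) 1) (.down ℕ) 0).hom.app (regular k Λ)).f 0) rfl ?_
  rw [HomologicalComplex.singleMapHomologicalComplex_hom_app_self]
  refine (congrArg (_ ≫ ·) (?_ : _ = 𝟙 _)).trans (Category.comp_id _)
  exact (Category.comp_id _).trans ((twist (ψ ^ m) 1).map_id (regular k Λ))

lemma twistedBarResolution_d [Module.Projective k Λ] (ψ : Λ ≃ₐ[k] Λ) (m i : ℕ) :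
    (twistedBarResolution ψ m).complex.d (i + 1) i =
      (twist (ψ ^ m) 1).map (barDelta k Λ (i + 1)) :=
  congrArg (twist (ψ ^ m) 1).map (barComplex_d k Λ i)

/-- A comparison of twisted bar resolutions given by compatible morphisms. -/
def barMapHom [Module.Projective k Λ] {ψ : Λ ≃ₐ[k] Λ} {m n : ℕ} {α β : Λ ≃ₐ[k] Λ}
    (e : ∀ i, twistedBar ψ n i ⟶ (twist α β).obj (twistedBar ψ m i))
    (g : twisted ψ n ⟶ (twist α β).obj (twisted ψ m))
    (he : ∀ i, (twist (ψ ^ n) 1).map (barDelta k Λ (i + 1)) ≫ e i =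
      e (i + 1) ≫ (twist α β).map ((twist (ψ ^ m) 1).map (barDelta k Λ (i + 1))))
    (hg : (twist (ψ ^ n) 1).map (barDelta k Λ 0) ≫ g =
      e 0 ≫ (twist α β).map ((twist (ψ ^ m) 1).map (barDelta k Λ 0))) :
    MapHom (twistedBarResolution ψ n) (twistedBarResolution ψ m) (twist α β) g where
  f := e
  comm i := by
    have h1 := twistedBarResolution_d ψ n i
    have h2 := twistedBarResolution_d ψ m i
    exact (congrArg (· ≫ e i) h1).trans ((he i).trans
      (congrArg (fun d => e (i + 1) ≫ (twist α β).map d) h2.symm))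
  comm_π := by
    have h1 := twistedBarResolution_π ψ n
    have h2 := twistedBarResolution_π ψ m
    exact (congrArg (· ≫ g) h1).trans (hg.trans
      (congrArg (fun d => e 0 ≫ (twist α β).map d) h2.symm))

lemma pow_add_apply (ψ : Λ ≃ₐ[k] Λ) (n m : ℕ) (a : Λ) :
    (ψ ^ (n + m)) a = (ψ ^ m) ((ψ ^ n) a) := by
  rw [add_comm, pow_add, AlgEquiv.mul_apply]

/-- Twisting on the left by `ψ ^ (n + m)` is twisting by `ψ ^ m` and then by `ψ ^ n`. -/
def twistAddLin (ψ : Λ ≃ₐ[k] Λ) (n m : ℕ) (X : Bimod k Λ) :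
    (twist (ψ ^ (n + m)) 1).obj X ≃ₗ[k] (twist (ψ ^ n) 1).obj ((twist (ψ ^ m) 1).obj X) :=
  untwist _ 1 X ≪≫ₗ (untwist (ψ ^ m) 1 X).symm ≪≫ₗ
    (untwist (ψ ^ n) 1 ((twist (ψ ^ m) 1).obj X)).symm

lemma twistAddLin_smul (ψ : Λ ≃ₐ[k] Λ) (n m : ℕ) (X : Bimod k Λ) (a b : Λ)
    (x : (twist (ψ ^ (n + m)) 1).obj X) :
    twistAddLin ψ n m X ((a ⊗ₜ[k] MulOpposite.op b : Env k Λ) • x) =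
      (a ⊗ₜ[k] MulOpposite.op b : Env k Λ) • twistAddLin ψ n m X x := by
  rw [twistAddLin, LinearEquiv.trans_apply, LinearEquiv.trans_apply,
    LinearEquiv.symm_apply_eq, LinearEquiv.symm_apply_eq, untwist_smul, untwist_smul,
    untwist_smul, LinearEquiv.trans_apply, LinearEquiv.trans_apply,
    LinearEquiv.apply_symm_apply, LinearEquiv.apply_symm_apply, pow_add_apply]
  rfl

/-- The comparison of left twists of the bar resolution with underlying map the identity. -/
def leftBarMapHom [Module.Projective k Λ] (ψ : Λ ≃ₐ[k] Λ) (n m : ℕ) :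
    MapHom (twistedBarResolution ψ (n + m)) (twistedBarResolution ψ m) (twist (ψ ^ n) 1)
      (twistedAddIso ψ n m).hom :=
  barMapHom (fun i => homMk (twistAddLin ψ n m (barTower k Λ (i + 1))).toLinearMap.toAddMonoidHom
    (twistAddLin_smul ψ n m _)) _ (fun _ => rfl) rfl

/-- The map `l₀ ⊗ ⋯ ⊗ lₙ ↦ χ l₀ ⊗ ⋯ ⊗ χ lₙ`. -/
def towerLin (χ : Λ ≃ₐ[k] Λ) : (n : ℕ) → barTower k Λ n →ₗ[k] barTower k Λ n
  | 0 =>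
    { toFun := fun x => (χ (show Λ from x) : Λ)
      map_add' := fun x y => map_add χ (show Λ from x) (show Λ from y)
      map_smul' := fun r x => (congrArg χ (regular_kModule_smul r x)).trans
        ((map_smul χ r (show Λ from x)).trans (regular_kModule_smul r (χ (show Λ from x))).symm) }
  | n + 1 => (toBarStep (barTower k Λ n)).toLinearMap ∘ₗ
      TensorProduct.map χ.toLinearMap (towerLin χ n) ∘ₗ (toBarStep (barTower k Λ n)).symm.toLinearMap

lemma towerLin_tmul (χ : Λ ≃ₐ[k] Λ) (n : ℕ) (c : Λ) (x : barTower k Λ n) :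
    towerLin χ (n + 1) (barTmul c x) = barTmul (χ c) (towerLin χ n x) := rfl

lemma towerLin_pure (χ : Λ ≃ₐ[k] Λ) (n : ℕ) (l : Fin (n + 1) → Λ) :
    towerLin χ n (pure k n l) = pure k n (fun i => χ (l i)) := by
  induction n with
  | zero => rfl
  | succ n ih => exact (towerLin_tmul χ n (l 0) _).trans (congrArg (barTmul (χ (l 0))) (ih _))

lemma towerLin_smul (χ : Λ ≃ₐ[k] Λ) (n : ℕ) (a b : Λ) (x : barTower k Λ n) :
    towerLin χ n ((a ⊗ₜ[k] MulOpposite.op b : Env k Λ) • x) =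
      (χ a ⊗ₜ[k] MulOpposite.op (χ b) : Env k Λ) • towerLin χ n x := by
  induction n generalizing a with
  | zero =>
    refine (congrArg χ (regular_smul a b x)).trans ?_
    refine Eq.trans ?_ (regular_smul (χ a) (χ b) (χ (show Λ from x))).symm
    rw [map_mul, map_mul]
  | succ n ih =>
    induction x using barTower_induction with
    | h0 => simp only [smul_zero, map_zero]
    | h1 c x =>
      have h1 := ih 1 x
      rw [map_one] at h1
      refine (congrArg (towerLin χ (n + 1)) (barStep_smul a b c x)).trans ?_
      refine Eq.trans ?_ (barStep_smul (χ a) (χ b) (χ c) (towerLin χ n x)).symm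
      rw [← h1, ← map_mul]
      exact towerLin_tmul χ n (a * c) _
    | h2 x y hx hy => rw [smul_add, map_add, map_add, smul_add, hx, hy]

/-- The differential only multiplies neighbouring factors, and `χ` is multiplicative. -/
lemma barDelta_towerLin (χ : Λ ≃ₐ[k] Λ) (n : ℕ) (x : barTower k Λ (n + 1)) :
    (barDelta k Λ n).hom (towerLin χ (n + 1) x) = towerLin χ n ((barDelta k Λ n).hom x) := by
  induction n with
  | zero =>
    induction x using barTower_induction with
    | h0 => simp only [map_zero]
    | h1 c x =>
      have h := towerLin_smul χ 0 c 1 x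
      rw [map_one] at h
      exact h.symm
    | h2 x y hx hy => simp only [map_add, hx, hy]
  | succ n ih =>
    induction x using barTower_induction with
    | h0 => simp only [map_zero]
    | h1 c x =>
      rw [towerLin_tmul, barDelta_succ_tmul, barDelta_succ_tmul, map_sub, ih, ← towerLin_tmul,
        towerLin_smul, map_one]
    | h2 x y hx hy => simp only [map_add, hx, hy]

/-- The map `towerLin χ` with `χ = ψ⁻ⁿ`, between twisted bimodules. -/
def towerTwistLin (ψ : Λ ≃ₐ[k] Λ) (n m i : ℕ) :
    (twist (ψ ^ (n + m)) 1).obj (barTower k Λ i) →ₗ[k]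
      (twist 1 (ψ ^ n)⁻¹).obj ((twist (ψ ^ m) 1).obj (barTower k Λ i)) :=
  (untwist 1 (ψ ^ n)⁻¹ ((twist (ψ ^ m) 1).obj (barTower k Λ i))).symm.toLinearMap ∘ₗ
    (untwist (ψ ^ m) 1 (barTower k Λ i)).symm.toLinearMap ∘ₗ
      towerLin (ψ ^ n)⁻¹ i ∘ₗ (untwist _ 1 (barTower k Λ i)).toLinearMap

lemma towerTwistLin_apply (ψ : Λ ≃ₐ[k] Λ) (n m i : ℕ)
    (x : (twist (ψ ^ (n + m)) 1).obj (barTower k Λ i)) :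
    towerTwistLin ψ n m i x =
      (untwist 1 (ψ ^ n)⁻¹ ((twist (ψ ^ m) 1).obj (barTower k Λ i))).symm
        ((untwist (ψ ^ m) 1 (barTower k Λ i)).symm
          (towerLin (ψ ^ n)⁻¹ i (untwist _ 1 (barTower k Λ i) x))) := rfl

lemma towerTwistLin_smul (ψ : Λ ≃ₐ[k] Λ) (n m i : ℕ) (a b : Λ)
    (x : (twist (ψ ^ (n + m)) 1).obj (barTower k Λ i)) :
    towerTwistLin ψ n m i ((a ⊗ₜ[k] MulOpposite.op b : Env k Λ) • x) =
      (a ⊗ₜ[k] MulOpposite.op b : Env k Λ) • towerTwistLin ψ n m i x := by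
  have h : (ψ ^ n)⁻¹ ((ψ ^ (n + m)) a) = (ψ ^ m) a := by
    rw [pow_add, ← AlgEquiv.mul_apply, inv_mul_cancel_left]
  rw [towerTwistLin_apply, towerTwistLin_apply,
    LinearEquiv.symm_apply_eq, LinearEquiv.symm_apply_eq, untwist_smul, untwist_smul,
    untwist_smul, towerLin_smul, h, LinearEquiv.apply_symm_apply, LinearEquiv.apply_symm_apply]
  rfl

/-- The comparison of twists of the bar resolution given by `ψ⁻ⁿ` on all tensor factors. -/
def rightBarMapHom [Module.Projective k Λ] (ψ : Λ ≃ₐ[k] Λ) (n m : ℕ) :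
    MapHom (twistedBarResolution ψ (n + m)) (twistedBarResolution ψ m) (twist 1 (ψ ^ n)⁻¹)
      (twistedInvIso ψ n m).hom :=
  barMapHom (fun i => homMk (towerTwistLin ψ n m (i + 1)).toAddMonoidHom
    (towerTwistLin_smul ψ n m _))  _ (fun i => by
      ext x
      exact (barDelta_towerLin (ψ ^ n)⁻¹ (i + 1) x).symm) (by
      ext x
      exact (barDelta_towerLin (ψ ^ n)⁻¹ 0 x).symm)

end Compare

end TwistedHochschild

/-! ### Invariant cocycles and the equality of the two twists -/

namespace CategoryTheory.ProjectiveResolution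

lemma MapHom.d_comp {C : Type*} [Category C] [Abelian C] {D : Type*} [Category D] [Abelian D]
    {F : C ⥤ D} [F.Additive] {X : C} {X' : D} {R' : ProjectiveResolution X'}
    {R : ProjectiveResolution X} {g : X' ⟶ F.obj X} (e : MapHom R' R F g) {n : ℕ} {Y : C}
    (f : R.complex.X n ⟶ Y) (hf : R.complex.d (n + 1) n ≫ f = 0) :
    R'.complex.d (n + 1) n ≫ e.f n ≫ F.map f = 0 := by
  rw [← Category.assoc, e.comm, Category.assoc, ← F.map_comp, hf, F.map_zero, Limits.comp_zero]

end CategoryTheory.ProjectiveResolution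

namespace TwistedHochschild

open Limits ProjectiveResolution

section Invariance

variable {k : Type u} [CommRing k] {Λ : Type v} [Ring Λ] [Algebra k Λ]

attribute [local instance] kModule kTower

lemma barTower_hom_ext {A : Type*} [AddCommGroup A] {n : ℕ} {u v : barTower k Λ n →+ A}
    (h : ∀ l, u (pure k n l) = v (pure k n l)) (x : barTower k Λ n) : u x = v x := by
  induction n with
  | zero => exact h fun _ => x
  | succ n ih =>
    induction x using barTower_induction with
    | h0 => rw [map_zero, map_zero]
    | h1 c x =>
      exact ih (u := u.comp (tmulHom n c)) (v := v.comp (tmulHom n c))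
        (fun l => h (Fin.cons c l)) x
    | h2 x y hx hy => rw [map_add, map_add, hx, hy]

/-- The last factor carries the right action, so a right linear map is determined on tensors ending
in `1`, the only ones that `CommutesWithInvPow` mentions. -/
lemma pure_snoc (n : ℕ) (l : Fin n → Λ) (b : Λ) :
    pure k n (Fin.snoc (α := fun _ => Λ) l b) =
      ract _ b (pure k n (Fin.snoc (α := fun _ => Λ) l 1)) := by
  induction n with
  | zero => exact ((ract_regular (Λ := Λ) b (1 : Λ)).trans (one_mul (M := Λ) b)).symm
  | succ n ih =>
    have h (b : Λ) : (fun i : Fin (n + 1) => Fin.snoc (α := fun _ => Λ) l b i.succ) =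
        Fin.snoc (α := fun _ => Λ) (fun i => l i.succ) b := by
      ext i
      refine Fin.lastCases ?_ (fun i => ?_) i
      · rw [Fin.succ_last, Fin.snoc_last, Fin.snoc_last]
      · rw [Fin.succ_castSucc, Fin.snoc_castSucc, Fin.snoc_castSucc]
    have h0 (b : Λ) : Fin.snoc (α := fun _ => Λ) l b 0 = l 0 := Fin.snoc_castSucc _ _ 0
    change barTmul _ (pure k n _) = ract _ b (barTmul _ (pure k n _))
    rw [h, h, h0, h0, ih]
    exact (ract_barStepTmul b (l 0) _).symm

/-- The hypothesis on tensors ending in `1` spreads to the whole bar term: pull the last factor out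
as a right action, then use additivity. -/
lemma CommutesWithInvPow.apply_towerLin {ψ : Λ ≃ₐ[k] Λ} {m N : ℕ}
    {f : twistedBar ψ m N ⟶ regular k Λ} {n : ℕ} (h : CommutesWithInvPow f n)
    (x : barTower k Λ (N + 1)) :
    twistHomLin f (towerLin (ψ ^ n)⁻¹ (N + 1) x) =
      ((ψ ^ n)⁻¹ (show Λ from twistHomLin f x) : Λ) := by
  refine barTower_hom_ext
    (u := (twistHomLin f ∘ₗ towerLin (ψ ^ n)⁻¹ (N + 1)).toAddMonoidHom)
    (v := (towerLin (ψ ^ n)⁻¹ 0 ∘ₗ twistHomLin f).toAddMonoidHom) (fun l => ?_) x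
  change twistHomLin f (towerLin (ψ ^ n)⁻¹ (N + 1) (pure k (N + 1) l)) =
    towerLin (ψ ^ n)⁻¹ 0 (twistHomLin f (pure k (N + 1) l))
  have h1 := h (Fin.init (α := fun _ => Λ) l)
  have h2 : towerLin (ψ ^ n)⁻¹ (N + 1) (pure k (N + 1) (Fin.snoc (α := fun _ => Λ)
      (Fin.init (α := fun _ => Λ) l) 1)) = pure k (N + 1) (Fin.snoc (α := fun _ => Λ)
      (fun i => (ψ ^ n)⁻¹ (Fin.init (α := fun _ => Λ) l i)) 1) := by
    rw [towerLin_pure]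
    congr 1
    ext i
    refine Fin.lastCases ?_ (fun i => ?_) i
    · rw [Fin.snoc_last, Fin.snoc_last, map_one]
    · rw [Fin.snoc_castSucc, Fin.snoc_castSucc]
  have h3 : ∀ (i : ℕ) (b : Λ) (x : barTower k Λ i), towerLin (ψ ^ n)⁻¹ i (ract _ b x) =
      ract _ ((ψ ^ n)⁻¹ b) (towerLin (ψ ^ n)⁻¹ i x) := fun i b x => by
    refine (towerLin_smul _ i 1 b x).trans ?_
    rw [map_one]
    rfl
  rw [← Fin.snoc_init_self (α := fun _ => Λ) l, pure_snoc, h3, twistHomLin_ract, twistHomLin_ract,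
    h2]
  refine Eq.trans ?_ (h3 0 _ _).symm
  exact congrArg (ract (regular k Λ) _) h1

/-- The right twist of a class by `ψ⁻ⁿ` is its left twist by `ψ ^ n` if the class has a cocycle
commuting with `ψ⁻ⁿ`. -/
theorem rightTwist_eq_leftTwist [Module.Projective k Λ] {ψ : Λ ≃ₐ[k] Λ} {t m n : ℕ}
    {η : HHDeg ψ t m} {f : twistedBar ψ m (t * m) ⟶ regular k Λ} (hη : Represents f η)
    (h : CommutesWithInvPow f n) : rightTwist n η = leftTwist n η := by
  obtain ⟨hf, rfl⟩ := hη
  have h1 := Ext.mk₀_comp_mapExactFunctor_extMk (leftBarMapHom ψ n m) f (t * m + 1) rfl hf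
    ((leftBarMapHom ψ n m).d_comp f hf)
  have h2 := Ext.mk₀_comp_mapExactFunctor_extMk (rightBarMapHom ψ n m) f (t * m + 1) rfl hf
    ((rightBarMapHom ψ n m).d_comp f hf)
  refine Eq.trans (congrArg (fun e => Ext.comp e (Ext.mk₀ (regularTwistIso ψ n).hom)
    (add_zero (t * m))) h2) (Eq.trans ?_ h1.symm)
  -- Both twists are now given by cocycles on the same resolution, and the cocycles themselves are
  -- equal, not merely cohomologous.
  rw [ProjectiveResolution.extMk_comp_mk₀]
  congr 1
  ext x
  have h3 := congrArg (fun y : Λ => (ψ ^ n) y) (h.apply_towerLin x)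
  refine h3.trans ?_
  exact (ψ ^ n).apply_symm_apply _

lemma CommutesWithInvPow.mul {ψ : Λ ≃ₐ[k] Λ} {m N : ℕ}
    {f : twistedBar ψ m N ⟶ regular k Λ} {n : ℕ} (h : CommutesWithInvPow f n) (q : ℕ) :
    CommutesWithInvPow f (n * q) := by
  induction q with
  | zero =>
    intro l
    rw [mul_zero, pow_zero, inv_one]
    rfl
  | succ q ih =>
    intro l
    rw [mul_add, mul_one, pow_add, mul_inv_rev]
    exact (h fun i => (ψ ^ (n * q))⁻¹ (l i)).trans (congrArg (fun y : Λ => (ψ ^ n)⁻¹ y) (ih l))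

end Invariance

end TwistedHochschild

/-! ### Graded commutation -/

lemma CategoryTheory.Abelian.Ext.mk₀_comp_comp_mk₀_eq {C : Type*} [Category* C] [Abelian C] [HasExt.{v} C]
    {A A₁ A₂ A₃ A₄ A₅ A₆ : C} {n : ℕ} {i : A ⟶ A₁} {e : Ext.{v} A₁ A₂ n}
    {r : A₂ ⟶ A₃} {d : A ⟶ A₄} {c : A₄ ⟶ A₁} {e' : Ext.{v} A₄ A₂ n} {fr : A₄ ⟶ A₅}
    {E : Ext.{v} A₅ A₃ n} {a : A ⟶ A₆} {j : A₆ ⟶ A₅} (hi : d ≫ c = i)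
    (he : e' = (mk₀ c).comp e (zero_add n))
    (hE : (mk₀ fr).comp E (zero_add n) = e'.comp (mk₀ r) (add_zero n)) (ha : d ≫ fr = a ≫ j) :
    ((mk₀ i).comp e (zero_add n)).comp (mk₀ r) (add_zero n) =
      (mk₀ a).comp ((mk₀ j).comp E (zero_add n)) (zero_add n) := by
  have h1 : (mk₀ a).comp ((mk₀ j).comp E (zero_add n)) (zero_add n) =
      (mk₀ (a ≫ j)).comp E (zero_add n) := by
    rw [← mk₀_comp_mk₀, comp_assoc_of_second_deg_zero]
  rw [h1, ← ha, ← hi, ← mk₀_comp_mk₀ d fr, comp_assoc_of_second_deg_zero, hE, he,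
    ← mk₀_comp_mk₀ d c, comp_assoc_of_second_deg_zero, comp_assoc_of_third_deg_zero]

lemma CategoryTheory.Abelian.Ext.mk₀_comp_comp_eq_smul {C : Type*} [Category* C] [Abelian C]
    [HasExt.{v} C] {A A₁ A₂ A₃ A₄ : C} {q n m : ℕ} {j : A ⟶ A₁} {α : Ext.{v} A₁ A₂ q}
    {e : Ext.{v} A₂ A₃ n} {E : Ext.{v} A₁ A₄ n} {θ : Ext.{v} A₄ A₃ q} {s : ℤ} {hm : q + n = m}
    {hm' : n + q = m} (h : α.comp e hm = s • E.comp θ hm') :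
    ((mk₀ j).comp α (zero_add q)).comp e hm = s • (mk₀ j).comp (E.comp θ hm') (zero_add m) := by
  rw [comp_assoc (mk₀ j) α e (zero_add q) hm (by lia), h, comp_zsmul]

lemma CategoryTheory.Abelian.Ext.mk₀_comp_mk₀_comp_comp {C : Type*} [Category* C] [Abelian C]
    [HasExt.{v} C] {A A₁ A₂ A₃ A₄ : C} {q n m m' : ℕ} {a : A ⟶ A₁} {j : A₁ ⟶ A₂} {E : Ext.{v} A₂ A₃ n}
    {θ : Ext.{v} A₃ A₄ q} (hm : n + q = m) (hm' : n + q = m') (h : 0 + m' = m) :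
    ((mk₀ a).comp ((mk₀ j).comp E (zero_add n)) (zero_add n)).comp θ hm =
      (mk₀ a).comp ((mk₀ j).comp (E.comp θ hm') (zero_add m')) h := by
  obtain rfl : m = m' := hm.symm.trans hm'
  rw [comp_assoc (mk₀ a) _ θ (zero_add n) hm (by lia),
    comp_assoc (mk₀ j) E θ (zero_add n) hm (by lia)]

namespace TwistedHochschild

open Limits

section Commutation

variable {k : Type u} [CommRing k] {Λ : Type v} [Ring Λ] [Algebra k Λ]

/-- The two products lie in the summands `m + l` and `l + m`, whose types differ; in the direct sum
they may be compared through `eqToHom`. -/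
lemma homog_eq_of_eqToHom_comp {ψ : Λ ≃ₐ[k] Λ} {t p p' : ℕ} (h : p' = p) (α : HHDeg ψ t p)
    (α' : HHDeg ψ t p')
    (hα : α' = (Ext.mk₀ (eqToHom (congrArg (twisted ψ) h))).comp (Z := regular k Λ) α
      (by rw [h, zero_add])) : homog α = homog α' := by
  subst h
  rw [hα]
  exact congrArg homog (Ext.mk₀_id_comp (Y := regular k Λ) α).symm

variable [Module.Projective k Λ]

/-- The isomorphism `x ↦ ψ⁻ˡ x` from `Λ` with left action twisted by `ψ ^ (l + m)` to the left twist
by `ψ ^ m` of `Λ` with right action twisted by `ψ⁻ˡ`. -/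
def twistedToTwist (ψ : Λ ≃ₐ[k] Λ) {l m p : ℕ} (hp : p = m + l) :
    twisted ψ p ⟶ (twist (ψ ^ m) 1).obj ((twist 1 (ψ ^ l)⁻¹).obj (regular k Λ)) :=
  eqToHom (congrArg (twisted ψ) hp) ≫ (twistedAddIso ψ m l).hom ≫
      (twist (ψ ^ m) 1).map (regularTwistIso ψ l).inv

omit [Module.Projective k Λ] in
lemma regularTwistIso_inv_hom (ψ : Λ ≃ₐ[k] Λ) (l : ℕ) (y : twisted ψ l) :
    (regularTwistIso ψ l).inv.hom y = (ψ ^ l)⁻¹ (show Λ from y) := by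
  have h1 : ∀ x : Λ, (regularTwistIso ψ l).hom.hom x = (ψ ^ l) x := fun _ => rfl
  have h2 : (regularTwistIso ψ l).hom.hom ((regularTwistIso ψ l).inv.hom y) = y :=
    ConcreteCategory.congr_hom (regularTwistIso ψ l).inv_hom_id y
  have h3 := (h1 _).symm.trans h2
  exact ((ψ ^ l).symm_apply_apply _).symm.trans (congrArg (fun z : Λ => (ψ ^ l).symm z) h3)

omit [Module.Projective k Λ] in
lemma twistedToTwist_twistCommApp (ψ : Λ ≃ₐ[k] Λ) {l m p : ℕ} (hp : p = m + l)
    (i : twisted ψ p ⟶ (twist 1 (ψ ^ l)⁻¹).obj (twisted ψ m))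
    (hi : ∀ x : Λ, i.hom x = (ψ ^ l)⁻¹ x) :
    twistedToTwist ψ hp ≫ twistCommApp (ψ ^ m) (ψ ^ l)⁻¹ (regular k Λ) = i := by
  subst hp
  have h : twistedToTwist ψ (l := l) (m := m) rfl =
      (twistedAddIso ψ m l).hom ≫ (twist (ψ ^ m) 1).map (regularTwistIso ψ l).inv :=
    Category.id_comp _
  rw [h]
  ext x
  exact (regularTwistIso_inv_hom ψ l x).trans (hi x).symm

omit [Module.Projective k Λ] in
lemma twistedToTwist_map (ψ : Λ ≃ₐ[k] Λ) {l m p : ℕ} (hp : p = m + l) :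
    twistedToTwist ψ hp ≫ (twist (ψ ^ m) 1).map (regularTwistIso ψ l).hom =
      eqToHom (congrArg (twisted ψ) hp) ≫ (twistedAddIso ψ m l).hom := by
  have h := ((twist (ψ ^ m) 1).mapIso (regularTwistIso ψ l)).inv_hom_id
  simp only [twistedToTwist, Category.assoc]
  refine congrArg (_ ≫ ·) ?_
  exact (congrArg (_ ≫ ·) h).trans (Category.comp_id _)

/-- The only use of invariance in the commutation. At `Λ` twisted by `ψ⁻ˡ` on the right the family
is the right twist of its value `η` at `Λ`; naturality along `ψˡ` transports it to `twisted ψ l`,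
and `hl` exchanges the right twist for the left one. -/
lemma leftTwist_eq_comp_naturalClass {ψ : Λ ≃ₐ[k] Λ} {t m l : ℕ} {η : HHDeg ψ t m}
    (h : (twist (ψ ^ m) 1).obj (syzygyIter (t * m) (regular k Λ)) ⟶ regular k Λ)
    (hη : naturalClass h (regular k Λ) = η) (hl : rightTwist l η = leftTwist l η) :
    leftTwist l η = (Ext.mk₀ (eqToHom (congrArg (twisted ψ) (add_comm l m)))).comp
      ((Ext.mk₀ (twistedAddIso ψ m l).hom).comp (naturalClass h (twisted ψ l)) (zero_add _))
        (zero_add _) := by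
  -- Graded naturality for a class of degree 0, where the sign is trivial.
  have h4 := mapExactFunctor_comp_naturalClass h (Ext.mk₀ (regularTwistIso ψ l).hom)
    (zero_add _) (add_zero _)
  rw [zero_mul, pow_zero, one_smul, Ext.mapExactFunctor_mk₀] at h4
  have h5 := naturalClass_twist h (ψ ^ l)⁻¹ (regular k Λ)
  rw [← hl]
  subst hη
  exact Ext.mk₀_comp_comp_mk₀_eq (twistedToTwist_twistCommApp ψ (add_comm l m) _
    fun _ => rfl) h5 h4 (twistedToTwist_map ψ (add_comm l m))

/-- Graded commutativity with the elements whose degree corresponds to a power of the automorphism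
under which the class is invariant. -/
theorem homog_mul_homog_comm {ψ : Λ ≃ₐ[k] Λ} {t m l : ℕ} {η : HHDeg ψ t m}
    (hl : rightTwist l η = leftTwist l η) (θ : HHDeg ψ t l) :
    homog η * homog θ = (-1 : ℤ) ^ ((t * m) * (t * l)) • (homog θ * homog η) := by
  obtain ⟨h, hη⟩ := exists_naturalClass_regular (φ := ψ ^ m) (n := t * m) η
  have h1 := leftTwist_eq_comp_naturalClass h hη hl
  -- At the target `Λ` of `θ` the family is `η`; at its source `twisted ψ l` it is the left twist of
  -- `η`, by `h1`. So this is the commutation itself, up to identifications.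
  have h2 := mapExactFunctor_comp_naturalClass h (X := twisted ψ l) (Y := regular k Λ)
    (q := t * l) θ (m := t * (m + l)) (by ring) (by ring)
  rw [hη] at h2
  have h3 : hmul η θ = (-1 : ℤ) ^ ((t * m) * (t * l)) •
      (show HHDeg ψ t (m + l) from (Ext.mk₀ (twistedAddIso ψ m l).hom).comp
        ((naturalClass h (twisted ψ l)).comp (Z := regular k Λ) θ
          (show t * m + t * l = t * (m + l) by ring)) (zero_add _)) :=
    Ext.mk₀_comp_comp_eq_smul (h2.trans (by rw [mul_comm (t * l) (t * m)]))
  rw [homog_mul, homog_mul, h3]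
  refine (map_zsmul (DirectSum.of (HHDeg ψ t) (m + l)) _ _).trans ?_
  refine congrArg (_ • ·) (homog_eq_of_eqToHom_comp (add_comm l m) _ _ ?_)
  change (leftTwist l η).comp (Z := regular k Λ) θ _ = _
  rw [h1]
  exact Ext.mk₀_comp_mk₀_comp_comp _ _ _

end Commutation

end TwistedHochschild

end

theorem mainTheorem10 {k : Type u} [CommRing k] [IsArtinianRing k]
    {Λ : Type v} [Ring Λ] [Algebra k Λ] [Module.Finite k Λ] [Module.Projective k Λ]
    (ψ : Λ ≃ₐ[k] Λ) (t : ℕ) (ht : 0 < t) (m : ℕ)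
    (η : TwistedHochschild.HHDeg ψ t m)
    (f : TwistedHochschild.twistedBar ψ m (t * m) ⟶ TwistedHochschild.regular k Λ)
    (hf : TwistedHochschild.Represents f η) :
    (∀ n : ℕ, 1 ≤ n → TwistedHochschild.CommutesWithInvPow f n →
      TwistedHochschild.rightTwist n η = TwistedHochschild.leftTwist n η ∧
      ∀ (l : ℕ) (θ : TwistedHochschild.HHDeg ψ t l), t * n ∣ t * l →
        TwistedHochschild.homog η * TwistedHochschild.homog θ =
          (-1 : ℤ) ^ ((t * m) * (t * l)) •
            (TwistedHochschild.homog θ * TwistedHochschild.homog η)) ∧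
    (TwistedHochschild.CommutesWithInvPow f 1 →
      TwistedHochschild.homog η ∈ TwistedHochschild.gradedCenter ψ t) := by
  have key : ∀ n : ℕ, TwistedHochschild.CommutesWithInvPow f n →
      ∀ (l : ℕ) (θ : TwistedHochschild.HHDeg ψ t l), t * n ∣ t * l →
        TwistedHochschild.homog η * TwistedHochschild.homog θ =
          (-1 : ℤ) ^ ((t * m) * (t * l)) •
            (TwistedHochschild.homog θ * TwistedHochschild.homog η) := by
    intro n hn l θ hl
    -- As `t` is positive it cancels, leaving `l = n * q`; iterating the invariance `q` times covers
    -- the degree of `θ`, including `q = 0`.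
    obtain ⟨q, rfl⟩ := (Nat.mul_dvd_mul_iff_left ht).1 hl
    exact TwistedHochschild.homog_mul_homog_comm
      (TwistedHochschild.rightTwist_eq_leftTwist hf (hn.mul q)) θ
  refine ⟨fun n _ hn => ⟨TwistedHochschild.rightTwist_eq_leftTwist hf hn, key n hn⟩, fun h1 => ?_⟩
  -- For `n = 1` the divisibility condition holds for every `θ`, so `η` is one of the generators.
  exact AddSubgroup.subset_closure ⟨m, η, rfl, fun l θ =>
    key 1 h1 l θ (by rw [mul_one]; exact dvd_mul_right t l)⟩
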